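/- For $0<k<1$ let $K(k)=\int_0^{\pi/2}\frac{d\theta}{\sqrt{1-k^2\sin^2\theta}}$ be the complete elliptic integral of the first kind, and put $b=\sqrt{1-k^2}$. For signs $\sigma_0,\sigma_1,\dots\in\{+,-\}$ consider the iteration $a_0=1$, $g_0=b$, $a_{n+1}=\frac{a_n+g_n}{2}$, $g_{n+1}=\sigma_n\sqrt{a_ng_n}$ over the complex numbers, where $\sqrt{a_ng_n}$ denotes the root nearer to the arithmetic mean, i.e. the root $r$ with $\operatorname{Re}\frac{r}{a_n+g_n}>0$; if $a_n$ and $g_n$ have exactly opposite directions, so that the two roots are equally near, the root with positive imaginary part is taken (convention $\varepsilon=+1$), or, alternatively, the one with negative imaginary part (convention $\varepsilon=-1$). Write $AGM_{\sigma_0,\sigma_1,\dots}(1,b)$ for the common limit of $(a_n)$ and $(g_n)$. 1. Under either convention, the limits $AGM_{+,+,+,\dots}(1,b)$ and $AGM_{-,+,+,\dots}(1,b)$ exist and are nonzero, and $$\frac{\pi}{2\,AGM_{+,+,+,\dots}(1,b)}=K(k),\qquad \frac{\pi}{2\,AGM_{-,+,+,\dots}(1,b)}=K(k)-\varepsilon\,4iK(b)=K(k)\mp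 4iK(b),$$ with the upper sign for $\varepsilon=+1$ and the lower sign for $\varepsilon=-1$. Hence the two values differ by $\pm4iK(b)$. 2. The number $4iK(b)$ is the second generator of the period lattice of the Jacobi elliptic functions of modulus $k$: the set of all common periods of $\operatorname{sn}(\cdot,k)$, $\operatorname{cn}(\cdot,k)$ and $\operatorname{dn}(\cdot,k)$ on $\mathbb C$ is $4K(k)\,\mathbb Z+4iK(b)\,\mathbb Z$. 3. Let $q,c\in(0,1)$ with $k=\frac{2\sqrt q}{1+q}$ and $q=\frac{2\sqrt c}{1+c}$, and let $v=\sqrt{1-q^2}$, $w=\frac{2\sqrt v}{1+v}$. Then $$K(k)=\frac{2}{1+b}\,\frac{2}{1+v}\,K(c),\qquad K(w)=\frac{2}{1+c}\,\frac{2}{1+q}\,K(b),\qquad K(k)K(w)=4K(b)K(c).$$ -/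

import Mathlib

/-- Complete elliptic integral of the first kind, as a function of the modulus `k`. -/
noncomputable def ellipticK (k : ℝ) : ℝ :=
  ∫ θ in (0 : ℝ)..(Real.pi / 2), 1 / Real.sqrt (1 - k ^ 2 * Real.sin θ ^ 2)

/-- The square root of `a * g` that is nearer to the arithmetic mean of `a` and `g`: the root `r`
for which `r / (a + g)` has positive real part. In the case of a tie (`a` and `g` exactly 180
degrees apart) the root with positive imaginary part is taken for `ε = 1`, and the root with
negative imaginary part for `ε = -1`. -/
noncomputable def nearRoot (ε : ℤˣ) (a g : ℂ) : ℂ :=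
  let r : ℂ := (a * g) ^ (1 / 2 : ℂ)
  if 0 < (r / (a + g)).re ∨ ((r / (a + g)).re = 0 ∧ 0 ≤ ((ε : ℤ) : ℝ) * r.im) then r else -r

/-- The sequence of pairs `(aₙ, gₙ)` of the AGM iteration started at `(a, g)` with sign choices `σ`:
`aₙ₊₁ = (aₙ + gₙ) / 2` and `gₙ₊₁ = σₙ √(aₙ gₙ)`, where `√` is the near root
and `ε` says how ties are resolved. -/
noncomputable def signedAGMSeq (ε : ℤˣ) (σ : ℕ → ℤˣ) (a g : ℂ) : ℕ → ℂ × ℂ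
  | 0 => (a, g)
  | n + 1 =>
    let p := signedAGMSeq ε σ a g n
    ((p.1 + p.2) / 2, ((σ n : ℤ) : ℂ) * nearRoot ε p.1 p.2)

/-- `M` is the AGM of `a` and `g` for the sign choices `σ`: both sequences converge to `M`. -/
def HasSignedAGM (ε : ℤˣ) (σ : ℕ → ℤˣ) (a g M : ℂ) : Prop :=
  Filter.Tendsto (fun n => (signedAGMSeq ε σ a g n).1) Filter.atTop (nhds M) ∧
    Filter.Tendsto (fun n => (signedAGMSeq ε σ a g n).2) Filter.atTop (nhds M)

/-- The sign choices `+, +, +, …`. -/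
def allPlus : ℕ → ℤˣ := fun _ => 1

/-- The sign choices `-, +, +, …`. -/
def firstMinus : ℕ → ℤˣ := fun n => if n = 0 then -1 else 1

/-- The theta parameter `τ = i K(k') / K(k)` of modulus `k`, with `k' = √(1 - k²)`;
the nome is `exp (π i τ)`. -/
noncomputable def ellipticTau (k : ℝ) : ℂ :=
  Complex.I * ellipticK (Real.sqrt (1 - k ^ 2)) / ellipticK k

/-! Jacobi's four theta functions, in the variable `u = ζ / π`, for which
`θ₁ = 2 ∑_{n ≥ 0} (-1)^n q^((n + 1/2)^2) sin ((2 n + 1) ζ)`, and so on, with `q = exp (π i τ)`. -/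

noncomputable def theta1 (u τ : ℂ) : ℂ :=
  -Complex.I * Complex.exp (Real.pi * Complex.I * (τ / 4 + u)) *
    jacobiTheta₂ (u + 1 / 2 + τ / 2) τ

noncomputable def theta2 (u τ : ℂ) : ℂ :=
  Complex.exp (Real.pi * Complex.I * (τ / 4 + u)) * jacobiTheta₂ (u + τ / 2) τ

noncomputable def theta3 (u τ : ℂ) : ℂ := jacobiTheta₂ u τ

noncomputable def theta4 (u τ : ℂ) : ℂ := jacobiTheta₂ (u + 1 / 2) τ

/-- The Jacobi elliptic function `sn (z, k)` (with value `0` at its poles), by the classical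
formula `θ₃(0) θ₁(ζ) / (θ₂(0) θ₄(ζ))` with `ζ = π z / (2 K(k))`. -/
noncomputable def jacobiSN (k : ℝ) (z : ℂ) : ℂ :=
  theta3 0 (ellipticTau k) * theta1 (z / (2 * ellipticK k)) (ellipticTau k) /
    (theta2 0 (ellipticTau k) * theta4 (z / (2 * ellipticK k)) (ellipticTau k))

/-- The Jacobi elliptic function `cn (z, k)` (with value `0` at its poles). -/
noncomputable def jacobiCN (k : ℝ) (z : ℂ) : ℂ :=
  theta4 0 (ellipticTau k) * theta2 (z / (2 * ellipticK k)) (ellipticTau k) /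
    (theta2 0 (ellipticTau k) * theta4 (z / (2 * ellipticK k)) (ellipticTau k))

/-- The Jacobi elliptic function `dn (z, k)` (with value `0` at its poles). -/
noncomputable def jacobiDN (k : ℝ) (z : ℂ) : ℂ :=
  theta4 0 (ellipticTau k) * theta3 (z / (2 * ellipticK k)) (ellipticTau k) /
    (theta3 0 (ellipticTau k) * theta4 (z / (2 * ellipticK k)) (ellipticTau k))

/-!
The proof has three strands. The first two rest on Gauss's integral
`I(a, g) = ∫₀^{π/2} dθ / √(a² cos² θ + g² sin² θ)`, for which `K(k) = I(1, b)`.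

*Real Landen transformation.* Newman's substitution `t = (x - a g / x) / 2` shows that
`I(a, g) = I((a + g) / 2, √(a g))` (`gaussIntegral_agm_step`). With homogeneity and symmetry this
gives `K(2 √k / (1 + k)) = (1 + k) K(k)` (`ellipticK_landen`) and the double Landen transformation.

*Complex means.* The function `z ↦ I(1, z)` is holomorphic on the right half-plane, so the
invariance extends to complex arguments by the identity theorem (`complexGauss_eq_step`). The mean
step sends the ratio `z = g / a` to `2 √z / (1 + z)`, which maps the slit plane into the right
half-plane; hence the near root is `a √(g / a)` with the principal root, and along the iteration
`I(1, gₙ / aₙ) / aₙ` is constant with limit `π / (2 M)` (`exists_tendsto_agmStep_iterate`). For the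
signs `+, +, …` this is Gauss's theorem. For the signs `-, +, +, …` the second pair is
`a₂ = ((1 + b) / 2 - √b) / 2` and `g₂ = ± i m`, the tie being resolved by `ε`. Its ratio lies on the
boundary of the half-plane of holomorphy, and the boundary value of the integral is found by
dominated convergence: the form `a₂² cos² θ - m² sin² θ` changes sign; the range where it is
positive contributes the real part, and the range where it is negative the imaginary part
(`complexGaussStep_mul_I`). Each part is again a real Gauss integral, namely `I(c, m)` and
`I(c, a₂)` with `c = ((1 + b) / 2 + √b) / 2`, and mean steps turn these into `I(1, b) = K(k)` and
`4 I(1, k) = 4 K(b)`.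

*Period lattice.* The triple product determines the zeros of Jacobi's theta function
(`exists_int_of_jacobiTheta₂_eq_zero`). A common period `ω` of `sn`, `cn`, `dn` satisfies `sn ω = 0`
and `cn ω = 1`, so `ω / (2 K(k))` is a zero of `θ₁`, and `ω = 2 m K(k) + 2 n i K(b)`. The signs that
`cn` and `dn` acquire under `2 K(k)` and `2 i K(b)` then force `m` and `n` to be even.
-/

open Complex Filter Topology

/-! ### The Jacobi triple product and the zeros of the theta function -/

/-- The finite Pochhammer product `(p; p)ₙ = ∏_{i = 1}^{n} (1 - pⁱ)`. -/
noncomputable def qPoch (p : ℂ) (n : ℕ) : ℂ := ∏ i ∈ Finset.range n, (1 - p ^ (i + 1))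

/-- The reciprocal `1 / (p; p)ⱼ`, extended by `0` to negative `j`; with this extension the
recursion `qPochInv_sub_one` holds for every integer. -/
noncomputable def qPochInv (p : ℂ) (j : ℤ) : ℂ := if j < 0 then 0 else (qPoch p j.toNat)⁻¹

lemma one_sub_pow_ne_zero {p : ℂ} (hp : ‖p‖ < 1) (i : ℕ) : 1 - p ^ (i + 1) ≠ 0 := by
  intro h
  have h1 : ‖p ^ (i + 1)‖ = 1 := by rw [← sub_eq_zero.mp h, norm_one]
  rw [norm_pow] at h1
  exact absurd h1 (pow_lt_one₀ (norm_nonneg p) hp (Nat.succ_ne_zero i)).ne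

lemma qPoch_ne_zero {p : ℂ} (hp : ‖p‖ < 1) (n : ℕ) : qPoch p n ≠ 0 :=
  Finset.prod_ne_zero_iff.mpr fun i _ => one_sub_pow_ne_zero hp i

lemma qPochInv_sub_one {p : ℂ} (hp : ‖p‖ < 1) (j : ℤ) :
    qPochInv p (j - 1) = (1 - p ^ j) * qPochInv p j := by
  rcases lt_trichotomy j 0 with h | rfl | h
  · simp [qPochInv, h, show j - 1 < 0 by lia]
  · simp [qPochInv]
  · obtain ⟨n, rfl⟩ : ∃ n : ℕ, j = n + 1 := ⟨(j - 1).toNat, by lia⟩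
    have h1 : ((n : ℤ) + 1).toNat = n + 1 := by lia
    have h2 := one_sub_pow_ne_zero hp n
    have h3 := qPoch_ne_zero hp n
    have h4 : p ^ ((n : ℤ) + 1) = p ^ (n + 1) := by exact_mod_cast zpow_natCast p (n + 1)
    simp only [qPochInv, add_sub_cancel_right, Int.toNat_natCast, h1, h4,
      show ¬ ((n : ℤ) < 0) by lia, show ¬ ((n : ℤ) + 1 < 0) by lia, if_false]
    rw [qPoch, qPoch, Finset.prod_range_succ] at *
    field_simp

lemma exists_tendsto_qPoch {p : ℂ} (hp : ‖p‖ < 1) :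
    ∃ Q : ℂ, Q ≠ 0 ∧ Tendsto (qPoch p) atTop (𝓝 Q) := by
  have hs : Summable fun i : ℕ => ‖-p ^ (i + 1)‖ := by
    simp only [norm_neg, norm_pow]
    exact (summable_nat_add_iff 1).mpr (summable_geometric_of_lt_one (norm_nonneg p) hp)
  refine ⟨∏' i : ℕ, (1 + -p ^ (i + 1)), tprod_one_add_ne_zero_of_summable
    (fun i => by simpa [← sub_eq_add_neg] using one_sub_pow_ne_zero hp i) hs, ?_⟩
  simpa [qPoch, ← sub_eq_add_neg, Function.comp_def] using!
    (multipliable_one_add_of_summable hs).hasProd.tendsto_prod_nat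

lemma exists_norm_qPochInv_le {p : ℂ} (hp : ‖p‖ < 1) : ∃ B : ℝ, ∀ j, ‖qPochInv p j‖ ≤ B := by
  obtain ⟨Q, hQ, hlim⟩ := exists_tendsto_qPoch hp
  obtain ⟨B, hB⟩ := (Metric.isBounded_range_of_tendsto _ (hlim.inv₀ hQ)).exists_norm_le
  refine ⟨B, fun j => ?_⟩
  rw [qPochInv]
  split_ifs
  · simpa using (norm_nonneg _).trans (hB _ ⟨0, rfl⟩)
  · exact hB _ ⟨j.toNat, rfl⟩

lemma tendsto_qPochInv {p Q : ℂ} (hQ : Q ≠ 0) (hlim : Tendsto (qPoch p) atTop (𝓝 Q)) :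
    Tendsto (qPochInv p) atTop (𝓝 Q⁻¹) := by
  have h1 : Tendsto Int.toNat atTop atTop :=
    tendsto_atTop.mpr fun b => (eventually_ge_atTop (b : ℤ)).mono fun j hj => by lia
  refine ((hlim.inv₀ hQ).comp h1).congr' ?_
  filter_upwards [eventually_ge_atTop (0 : ℤ)] with j hj
  simp [qPochInv, not_lt.mpr hj]

/-- The finite form of the Jacobi triple product, a Laurent polynomial identity in `z` whose
coefficients are `q ^ m²` times the Gaussian binomial coefficients of `2 n` over `n + m` in base
`q²`. -/
lemma hasSum_finite_triple_product {q z : ℂ} (hq : ‖q‖ < 1) (hq0 : q ≠ 0) (hz : z ≠ 0) (n : ℕ) :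
    HasSum (fun m : ℤ => qPoch (q ^ 2) (2 * n) * qPochInv (q ^ 2) (n - m) *
        qPochInv (q ^ 2) (n + m) * (q ^ (m ^ 2) * z ^ m))
      (∏ j ∈ Finset.range n, ((1 + q ^ (2 * j + 1) * z) * (1 + q ^ (2 * j + 1) * z⁻¹))) := by
  have hp : ‖q ^ 2‖ < 1 := by rw [norm_pow]; exact pow_lt_one₀ (norm_nonneg q) hq two_ne_zero
  induction n with
  | zero =>
    convert hasSum_single (0 : ℤ) ?_ using 1
    · simp [qPoch, qPochInv]
    · intro m hm
      rcases lt_or_gt_of_ne hm with h | h <;> simp [qPochInv, h]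
  | succ n ih =>
    rw [Finset.prod_range_succ]
    set S := ∏ j ∈ Finset.range n, ((1 + q ^ (2 * j + 1) * z) * (1 + q ^ (2 * j + 1) * z⁻¹))
    obtain ⟨c, hc⟩ : ∃ c : ℤ → ℂ, c = fun m => qPoch (q ^ 2) (2 * n) * qPochInv (q ^ 2) (n - m) *
        qPochInv (q ^ 2) (n + m) * (q ^ (m ^ 2) * z ^ m) := ⟨_, rfl⟩
    rw [← hc] at ih
    -- Multiplication by `z` and by `z⁻¹` shifts the index by one.
    have hdown : HasSum (fun m : ℤ => c (m - 1)) S := 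
      (Equiv.hasSum_iff (f := c) (Equiv.subRight (1 : ℤ))).mpr ih
    have hup : HasSum (fun m : ℤ => c (m + 1)) S := 
      (Equiv.hasSum_iff (f := c) (Equiv.addRight (1 : ℤ))).mpr ih
    have hstep := ((ih.mul_left (1 + q ^ (4 * n + 2))).add
      (hdown.mul_left (q ^ (2 * n + 1) * z))).add (hup.mul_left (q ^ (2 * n + 1) * z⁻¹))
    refine (congrArg₂ (fun f s => HasSum f s) (funext fun m => ?_) ?_).mpr hstep
    · clear hstep hdown hup ih
      have hA := qPochInv_sub_one hp (n + 1 - m)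
      have hA' := qPochInv_sub_one hp (n - m)
      have hB := qPochInv_sub_one hp (n + 1 + m)
      have hB' := qPochInv_sub_one hp (n + m)
      rw [show (n : ℤ) + 1 - m - 1 = n - m by ring] at hA
      rw [show (n : ℤ) + 1 + m - 1 = n + m by ring] at hB
      rw [hA] at hA'
      rw [hB] at hB'
      have hQ : qPoch (q ^ 2) (2 * (n + 1)) =
          qPoch (q ^ 2) (2 * n) * (1 - (q ^ 2) ^ (2 * n + 1)) * (1 - (q ^ 2) ^ (2 * n + 2)) := by
        rw [show 2 * (n + 1) = 2 * n + 1 + 1 by ring, qPoch, Finset.prod_range_succ,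
          Finset.prod_range_succ, ← qPoch]
      simp only [hc, hQ]
      push_cast
      rw [show (n : ℤ) - (m - 1) = n + 1 - m by ring, show (n : ℤ) + (m - 1) = n + m - 1 by ring,
        show (n : ℤ) - (m + 1) = n - m - 1 by ring, show (n : ℤ) + (m + 1) = n + 1 + m by ring,
        hA', hB', hA, hB, show (m - 1) ^ 2 = m ^ 2 - 2 * m + 1 by ring,
        show (m + 1) ^ 2 = m ^ 2 + 2 * m + 1 by ring]
      have e1 : (q ^ 2) ^ ((n : ℤ) + 1 - m) = q ^ (2 * n + 2) * q ^ (-(2 * m)) := by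
        rw [← zpow_natCast, ← zpow_natCast, ← zpow_mul, ← zpow_add₀ hq0]; congr 1; push_cast; ring
      have e2 : (q ^ 2) ^ ((n : ℤ) + 1 + m) = q ^ (2 * n + 2) * q ^ (2 * m) := by
        rw [← zpow_natCast, ← zpow_natCast, ← zpow_mul, ← zpow_add₀ hq0]; congr 1; push_cast; ring
      have e3 : (q ^ 2) ^ ((n : ℤ) - m) = q ^ (2 * n) * q ^ (-(2 * m)) := by
        rw [← zpow_natCast, ← zpow_natCast, ← zpow_mul, ← zpow_add₀ hq0]; congr 1; push_cast; ring
      have e4 : (q ^ 2) ^ ((n : ℤ) + m) = q ^ (2 * n) * q ^ (2 * m) := by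
        rw [← zpow_natCast, ← zpow_natCast, ← zpow_mul, ← zpow_add₀ hq0]; congr 1; push_cast; ring
      rw [e1, e2, e3, e4, zpow_add₀ hq0 (m ^ 2 - 2 * m), zpow_sub₀ hq0,
        zpow_add₀ hq0 (m ^ 2 + 2 * m), zpow_add₀ hq0 (m ^ 2), zpow_sub₀ hz, zpow_add₀ hz, zpow_neg]
      have h5 : q ^ (2 * m) ≠ 0 := zpow_ne_zero _ hq0
      generalize q ^ (2 * m) = x at *
      generalize q ^ (m ^ 2) = y at *
      generalize z ^ m = w at *
      simp only [zpow_one]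
      field_simp
      ring
    · field_simp
      ring

/-- The Jacobi triple product: up to a nonzero constant, the theta function
is the infinite product with the evident zeros. -/
lemma exists_jacobiTheta₂_eq_mul_tprod {τ : ℂ} (hτ : 0 < τ.im) (w : ℂ) :
    ∃ C : ℂ, C ≠ 0 ∧
      C * jacobiTheta₂ w τ =
        (∏' j : ℕ, (1 + cexp (Real.pi * I * ((2 * j + 1) * τ + 2 * w)))) *
          ∏' j : ℕ, (1 + cexp (Real.pi * I * ((2 * j + 1) * τ - 2 * w))) := by
  set q := cexp (Real.pi * I * τ) with hqdef
  set z := cexp (2 * Real.pi * I * w) with hzdef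
  have hq0 : q ≠ 0 := exp_ne_zero _
  have hz0 : z ≠ 0 := exp_ne_zero _
  have hq : ‖q‖ < 1 := by
    rw [hqdef, norm_exp, Real.exp_lt_one_iff]
    simp [mul_pos Real.pi_pos hτ]
  have hp : ‖q ^ 2‖ < 1 := by rw [norm_pow]; exact pow_lt_one₀ (norm_nonneg q) hq two_ne_zero
  obtain ⟨Q, hQ, hlim⟩ := exists_tendsto_qPoch hp
  obtain ⟨B, hB⟩ := exists_norm_qPochInv_le hp
  obtain ⟨B', hB'⟩ := (Metric.isBounded_range_of_tendsto _ hlim).exists_norm_le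
  have hterm (m : ℤ) : q ^ (m ^ 2) * z ^ m = jacobiTheta₂_term m w τ := by
    rw [hqdef, hzdef, jacobiTheta₂_term, ← exp_int_mul, ← exp_int_mul, ← Complex.exp_add]
    congr 1; push_cast; ring
  have hfac (s : ℂ) : Tendsto (fun n => ∏ j ∈ Finset.range n,
      (1 + cexp (Real.pi * I * ((2 * j + 1) * τ + s)))) atTop
      (𝓝 (∏' j : ℕ, (1 + cexp (Real.pi * I * ((2 * j + 1) * τ + s))))) := by
    refine (multipliable_one_add_of_summable ?_).hasProd.tendsto_prod_nat
    have : ∀ j : ℕ, ‖cexp (Real.pi * I * ((2 * j + 1) * τ + s))‖ =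
        ‖cexp (Real.pi * I * (τ + s))‖ * (‖q ^ 2‖) ^ j := by
      intro j
      rw [← norm_pow, ← norm_mul, hqdef, ← Complex.exp_nat_mul, ← Complex.exp_nat_mul,
        ← Complex.exp_add]
      congr 2; push_cast; ring
    simp only [this]
    exact (summable_geometric_of_lt_one (norm_nonneg _) hp).mul_left _
  have hprod := (hfac (2 * w)).mul (hfac (-(2 * w)))
  have hsum : Tendsto (fun n : ℕ => ∑' m : ℤ, qPoch (q ^ 2) (2 * n) * qPochInv (q ^ 2) (n - m) *
        qPochInv (q ^ 2) (n + m) * (q ^ (m ^ 2) * z ^ m)) atTop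
      (𝓝 (∑' m : ℤ, Q * Q⁻¹ * Q⁻¹ * (q ^ (m ^ 2) * z ^ m))) := by
    refine tendsto_tsum_of_dominated_convergence
      (bound := fun m => B' * B * B * ‖jacobiTheta₂_term m w τ‖) ?_ ?_ (.of_forall ?_)
    · exact ((summable_jacobiTheta₂_term_iff w τ).mpr hτ).norm.mul_left _
    · intro m
      have h1 : Tendsto (fun n : ℕ => qPoch (q ^ 2) (2 * n)) atTop (𝓝 Q) :=
        hlim.comp (tendsto_id.const_mul_atTop' two_pos)
      have h2 : Tendsto (fun n : ℕ => qPochInv (q ^ 2) (n - m)) atTop (𝓝 Q⁻¹) :=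
        (tendsto_qPochInv hQ hlim).comp
          (tendsto_atTop_add_const_right _ (-m) tendsto_natCast_atTop_atTop)
      have h3 : Tendsto (fun n : ℕ => qPochInv (q ^ 2) (n + m)) atTop (𝓝 Q⁻¹) :=
        (tendsto_qPochInv hQ hlim).comp
          (tendsto_atTop_add_const_right _ m tendsto_natCast_atTop_atTop)
      exact ((h1.mul h2).mul h3).mul_const _
    · intro n m
      have hB0 : 0 ≤ B := (norm_nonneg _).trans (hB 0)
      have hB0' : 0 ≤ B' := (norm_nonneg _).trans (hB' _ ⟨0, rfl⟩)
      rw [norm_mul, norm_mul, norm_mul, hterm]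
      gcongr
      exacts [hB' _ ⟨_, rfl⟩, hB _, hB _]
  refine ⟨Q⁻¹, inv_ne_zero hQ, ?_⟩
  have hval : ∑' m : ℤ, Q * Q⁻¹ * Q⁻¹ * (q ^ (m ^ 2) * z ^ m) = Q⁻¹ * jacobiTheta₂ w τ := by
    simp only [hterm, mul_inv_cancel₀ hQ, one_mul, tsum_mul_left, jacobiTheta₂]
  rw [← hval]
  simp only [← sub_eq_add_neg] at hprod
  refine tendsto_nhds_unique hsum (hprod.congr fun n => ?_)
  rw [(hasSum_finite_triple_product hq hq0 hz0 n).tsum_eq, ← Finset.prod_mul_distrib]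
  refine Finset.prod_congr rfl fun j _ => ?_
  congr 2
  · rw [hqdef, hzdef, ← Complex.exp_nat_mul, ← Complex.exp_add]
    congr 1; push_cast; ring
  · rw [hqdef, hzdef, ← Complex.exp_neg, ← Complex.exp_nat_mul, ← Complex.exp_add]
    congr 1; push_cast; ring

/-- The zeros of the theta function lie in the coset `1/2 + τ/2 + ℤ + ℤ τ`. -/
lemma exists_int_of_jacobiTheta₂_eq_zero {τ w : ℂ} (hτ : 0 < τ.im) (h : jacobiTheta₂ w τ = 0) :
    ∃ m n : ℤ, w = 1 / 2 + τ / 2 + m + n * τ := by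
  obtain ⟨C, -, hC⟩ := exists_jacobiTheta₂_eq_mul_tprod hτ w
  rw [h, mul_zero, eq_comm, mul_eq_zero] at hC
  have key (s : ℂ) (hs : ∏' j : ℕ, (1 + cexp (Real.pi * I * ((2 * j + 1) * τ + s))) = 0) :
      ∃ m n : ℤ, s = 1 + τ + 2 * m + 2 * n * τ := by
    by_contra hcon
    refine tprod_one_add_ne_zero_of_summable (f := fun j : ℕ =>
      cexp (Real.pi * I * ((2 * j + 1) * τ + s))) (fun j hj => hcon ?_) ?_ hs
    · have h1 : cexp (Real.pi * I * ((2 * j + 1) * τ + s)) = cexp (Real.pi * I) := by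
        rw [exp_pi_mul_I]; linear_combination hj
      obtain ⟨n, hn⟩ := exp_eq_exp_iff_exists_int.mp h1
      have hpi : (Real.pi : ℂ) * I ≠ 0 := by simp [Real.pi_ne_zero]
      have h2 : (2 * j + 1) * τ + s = 1 + 2 * n := by
        apply mul_left_cancel₀ hpi; rw [hn]; ring
      refine ⟨n, -j - 1, ?_⟩
      push_cast
      linear_combination h2
    · have hq : Real.exp (-(2 * Real.pi * τ.im)) < 1 := by
        rw [Real.exp_lt_one_iff]; nlinarith [mul_pos Real.pi_pos hτ]
      have : ∀ j : ℕ, ‖cexp (Real.pi * I * ((2 * j + 1) * τ + s))‖ =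
          ‖cexp (Real.pi * I * (τ + s))‖ * Real.exp (-(2 * Real.pi * τ.im)) ^ j := by
        intro j
        rw [norm_exp, norm_exp, ← Real.exp_nat_mul, ← Real.exp_add]
        congr 1
        simp
        ring
      simp only [this]
      exact (summable_geometric_of_lt_one (Real.exp_nonneg _) hq).mul_left _
  rcases hC with h1 | h1
  · obtain ⟨m, n, hmn⟩ := key _ h1
    exact ⟨m, n, by linear_combination hmn / 2⟩
  · simp only [sub_eq_add_neg] at h1
    obtain ⟨m, n, hmn⟩ := key _ h1
    refine ⟨-m - 1, -n - 1, ?_⟩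
    push_cast
    linear_combination -hmn / 2

/-! ### The period lattice of the Jacobi elliptic functions -/

lemma exp_pi_mul_I_mul_add_one (s : ℂ) :
    cexp (Real.pi * I * (s + 1)) = -cexp (Real.pi * I * s) := by
  rw [mul_add, Complex.exp_add, mul_one, exp_pi_mul_I, mul_neg_one]

lemma theta1_add_one (u τ : ℂ) : theta1 (u + 1) τ = -theta1 u τ := by
  rw [theta1, theta1, ← add_assoc, exp_pi_mul_I_mul_add_one,
    show u + 1 + 1 / 2 + τ / 2 = u + 1 / 2 + τ / 2 + 1 by ring, jacobiTheta₂_add_left]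
  ring

lemma theta2_add_one (u τ : ℂ) : theta2 (u + 1) τ = -theta2 u τ := by
  rw [theta2, theta2, ← add_assoc, exp_pi_mul_I_mul_add_one,
    show u + 1 + τ / 2 = u + τ / 2 + 1 by ring, jacobiTheta₂_add_left]
  ring

lemma theta3_add_one (u τ : ℂ) : theta3 (u + 1) τ = theta3 u τ := jacobiTheta₂_add_left u τ

lemma theta4_add_one (u τ : ℂ) : theta4 (u + 1) τ = theta4 u τ := by
  rw [theta4, theta4, add_right_comm, jacobiTheta₂_add_left]

lemma theta3_add_tau (u τ : ℂ) :
    theta3 (u + τ) τ = cexp (-Real.pi * I * (τ + 2 * u)) * theta3 u τ :=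
  jacobiTheta₂_add_left' u τ

lemma theta4_add_tau (u τ : ℂ) :
    theta4 (u + τ) τ = -cexp (-Real.pi * I * (τ + 2 * u)) * theta4 u τ := by
  rw [theta4, theta4, add_right_comm, jacobiTheta₂_add_left',
    show -(Real.pi : ℂ) * I * (τ + 2 * (u + 1 / 2)) = -(Real.pi * I) + -Real.pi * I * (τ + 2 * u) by
      ring, Complex.exp_add, Complex.exp_neg, exp_pi_mul_I]
  norm_num

lemma theta2_add_tau (u τ : ℂ) :
    theta2 (u + τ) τ = cexp (-Real.pi * I * (τ + 2 * u)) * theta2 u τ := by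
  rw [theta2, theta2, add_right_comm, jacobiTheta₂_add_left', ← mul_assoc, ← mul_assoc,
    ← Complex.exp_add, ← Complex.exp_add]
  congr 2; ring

lemma theta1_add_tau (u τ : ℂ) :
    theta1 (u + τ) τ = -cexp (-Real.pi * I * (τ + 2 * u)) * theta1 u τ := by
  rw [theta1, theta1, show u + τ + 1 / 2 + τ / 2 = u + 1 / 2 + τ / 2 + τ by ring,
    jacobiTheta₂_add_left']
  have h : cexp (Real.pi * I * (τ / 4 + (u + τ))) *
        cexp (-Real.pi * I * (τ + 2 * (u + 1 / 2 + τ / 2))) =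
      -(cexp (-Real.pi * I * (τ + 2 * u)) * cexp (Real.pi * I * (τ / 4 + u))) := by
    rw [← Complex.exp_add, ← Complex.exp_add,
      show (Real.pi : ℂ) * I * (τ / 4 + (u + τ)) + -Real.pi * I * (τ + 2 * (u + 1 / 2 + τ / 2)) =
        -(Real.pi * I) + (-Real.pi * I * (τ + 2 * u) + Real.pi * I * (τ / 4 + u)) by ring,
      Complex.exp_add, Complex.exp_neg, exp_pi_mul_I]
    norm_num
  linear_combination (-I * jacobiTheta₂ (u + 1 / 2 + τ / 2) τ) * h

lemma theta1_zero (τ : ℂ) : theta1 0 τ = 0 := by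
  have h1 : jacobiTheta₂ (1 / 2 + τ / 2) τ = -jacobiTheta₂ (1 / 2 + τ / 2) τ := by
    calc jacobiTheta₂ (1 / 2 + τ / 2) τ = jacobiTheta₂ (-(1 / 2 + τ / 2) + 1 + τ) τ := by
          congr 1; ring
      _ = -jacobiTheta₂ (1 / 2 + τ / 2) τ := by
          rw [jacobiTheta₂_add_left', jacobiTheta₂_add_left, jacobiTheta₂_neg_left,
            show -(Real.pi : ℂ) * I * (τ + 2 * (-(1 / 2 + τ / 2) + 1)) = -(Real.pi * I) by ring,
            Complex.exp_neg, exp_pi_mul_I]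
          norm_num
  rw [theta1, zero_add, self_eq_neg.mp h1, mul_zero]

lemma exists_int_of_theta1_eq_zero {u τ : ℂ} (hτ : 0 < τ.im) (h : theta1 u τ = 0) :
    ∃ m n : ℤ, u = m + n * τ := by
  have h1 : jacobiTheta₂ (u + 1 / 2 + τ / 2) τ = 0 := by simpa [theta1] using h
  obtain ⟨m, n, hmn⟩ := exists_int_of_jacobiTheta₂_eq_zero hτ h1
  exact ⟨m, n, by linear_combination hmn⟩

/-- A purely imaginary `τ ≠ 0` and `1` are linearly independent over `ℝ`. -/
lemma ofReal_add_mul_tau_eq_zero {τ : ℂ} (hτ : 0 < τ.im) (hre : τ.re = 0) {a b : ℝ}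
    (h : (a : ℂ) + b * τ = 0) : a = 0 ∧ b = 0 := by
  have h1 := congrArg Complex.im h
  have h2 := congrArg Complex.re h
  simp [hre] at h1 h2
  exact ⟨h2, h1.resolve_right hτ.ne'⟩

lemma jacobiTheta₂_ne_zero {τ w : ℂ} (hτ : 0 < τ.im) (hre : τ.re = 0) {r s : ℝ}
    (hw : w = r + s * τ) (h : ¬ ∃ m n : ℤ, r = 1 / 2 + m ∧ s = 1 / 2 + n) :
    jacobiTheta₂ w τ ≠ 0 := by
  intro h0
  obtain ⟨m, n, hmn⟩ := exists_int_of_jacobiTheta₂_eq_zero hτ h0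
  have := ofReal_add_mul_tau_eq_zero hτ hre (a := r - 1 / 2 - m) (b := s - 1 / 2 - n) (by
    push_cast; linear_combination hmn - hw)
  exact h ⟨m, n, by linarith [this.1], by linarith [this.2]⟩

lemma half_add_int_ne_zero (m : ℤ) : (0 : ℝ) ≠ 1 / 2 + m := by
  intro h
  have : (2 * m + 1 : ℝ) = 0 := by linarith
  have : 2 * m + 1 = 0 := by exact_mod_cast this
  lia

lemma theta2_zero_ne_zero {τ : ℂ} (hτ : 0 < τ.im) (hre : τ.re = 0) : theta2 0 τ ≠ 0 :=
  mul_ne_zero (exp_ne_zero _) (jacobiTheta₂_ne_zero hτ hre (r := 0) (s := 1 / 2)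
    (by push_cast; ring) fun ⟨m, _, h, _⟩ => half_add_int_ne_zero m h)

lemma theta3_zero_ne_zero {τ : ℂ} (hτ : 0 < τ.im) (hre : τ.re = 0) : theta3 0 τ ≠ 0 :=
  jacobiTheta₂_ne_zero hτ hre (r := 0) (s := 0)
    (by push_cast; ring) fun ⟨m, _, h, _⟩ => half_add_int_ne_zero m h

lemma theta4_zero_ne_zero {τ : ℂ} (hτ : 0 < τ.im) (hre : τ.re = 0) : theta4 0 τ ≠ 0 :=
  jacobiTheta₂_ne_zero hτ hre (r := 1 / 2) (s := 0)
    (by push_cast; ring) fun ⟨_, n, _, h⟩ => half_add_int_ne_zero n h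

lemma ellipticK_pos {k : ℝ} (hk : k ^ 2 < 1) : 0 < ellipticK k := by
  have hpos (θ : ℝ) : 0 < 1 - k ^ 2 * Real.sin θ ^ 2 := by
    nlinarith [Real.sin_sq_le_one θ, sq_nonneg k, sq_nonneg (Real.sin θ)]
  refine intervalIntegral.intervalIntegral_pos_of_pos ?_
    (fun θ => one_div_pos.mpr (Real.sqrt_pos.mpr (hpos θ))) (by positivity)
  refine Continuous.intervalIntegrable ?_ _ _
  exact continuous_const.div (by fun_prop) fun θ => (Real.sqrt_pos.mpr (hpos θ)).ne'

section Periods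

variable {k : ℝ}

lemma add_two_mul_ellipticK_div (hK : ellipticK k ≠ 0) (z : ℂ) :
    (z + 2 * ellipticK k) / (2 * ellipticK k) = z / (2 * ellipticK k) + 1 := by
  have : (ellipticK k : ℂ) ≠ 0 := by exact_mod_cast hK
  field_simp

lemma add_two_mul_I_mul_ellipticK_div (hK : ellipticK k ≠ 0) (z : ℂ) :
    (z + 2 * I * ellipticK (Real.sqrt (1 - k ^ 2))) / (2 * ellipticK k) =
      z / (2 * ellipticK k) + ellipticTau k := by
  have : (ellipticK k : ℂ) ≠ 0 := by exact_mod_cast hK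
  rw [ellipticTau]
  field_simp

lemma jacobiSN_antiperiodic (hK : ellipticK k ≠ 0) :
    Function.Antiperiodic (jacobiSN k) (2 * ellipticK k) := fun z => by
  rw [jacobiSN, jacobiSN, add_two_mul_ellipticK_div hK, theta1_add_one, theta4_add_one]
  ring

lemma jacobiCN_antiperiodic (hK : ellipticK k ≠ 0) :
    Function.Antiperiodic (jacobiCN k) (2 * ellipticK k) := fun z => by
  rw [jacobiCN, jacobiCN, add_two_mul_ellipticK_div hK, theta2_add_one, theta4_add_one]
  ring

lemma jacobiDN_periodic (hK : ellipticK k ≠ 0) :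
    Function.Periodic (jacobiDN k) (2 * ellipticK k) := fun z => by
  rw [jacobiDN, jacobiDN, add_two_mul_ellipticK_div hK, theta3_add_one, theta4_add_one]

lemma jacobiSN_periodic_imag (hK : ellipticK k ≠ 0) :
    Function.Periodic (jacobiSN k) (2 * I * ellipticK (Real.sqrt (1 - k ^ 2))) := fun z => by
  rw [jacobiSN, jacobiSN, add_two_mul_I_mul_ellipticK_div hK, theta1_add_tau, theta4_add_tau,
    mul_left_comm, mul_left_comm (theta2 _ _)]
  exact mul_div_mul_left _ _ (neg_ne_zero.mpr (exp_ne_zero _))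

lemma jacobiCN_antiperiodic_imag (hK : ellipticK k ≠ 0) :
    Function.Antiperiodic (jacobiCN k) (2 * I * ellipticK (Real.sqrt (1 - k ^ 2))) := fun z => by
  rw [jacobiCN, jacobiCN, add_two_mul_I_mul_ellipticK_div hK, theta2_add_tau, theta4_add_tau,
    mul_left_comm, mul_left_comm (theta2 0 _), neg_mul (cexp _), div_neg]
  rw [mul_div_mul_left _ _ (exp_ne_zero _)]

lemma jacobiDN_antiperiodic_imag (hK : ellipticK k ≠ 0) :
    Function.Antiperiodic (jacobiDN k) (2 * I * ellipticK (Real.sqrt (1 - k ^ 2))) := fun z => by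
  rw [jacobiDN, jacobiDN, add_two_mul_I_mul_ellipticK_div hK, theta3_add_tau, theta4_add_tau,
    mul_left_comm, mul_left_comm (theta3 0 _), neg_mul (cexp _), div_neg]
  rw [mul_div_mul_left _ _ (exp_ne_zero _)]

/-- A common period `ω` is a zero of `sn` at which `cn` does not vanish, so `ω / (2 K(k))` is a zero
of `θ₁` and `ω = 2 m K(k) + 2 n i K(k')`; the signs of `dn ω` and `cn ω` force `m` and `n` to be
even. -/
theorem setOf_common_periods_eq (hk0 : 0 < k) (hk1 : k < 1) :
    {ω : ℂ | Function.Periodic (jacobiSN k) ω ∧ Function.Periodic (jacobiCN k) ω ∧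
        Function.Periodic (jacobiDN k) ω} =
      (AddSubgroup.closure {4 * (ellipticK k : ℂ),
        4 * I * (ellipticK (Real.sqrt (1 - k ^ 2)) : ℂ)} : Set ℂ) := by
  have hk2 : k ^ 2 < 1 := by nlinarith
  have hKpos : 0 < ellipticK k := ellipticK_pos hk2
  have hK := hKpos.ne'
  have hKC : (ellipticK k : ℂ) ≠ 0 := by exact_mod_cast hK
  have hK'pos : 0 < ellipticK (Real.sqrt (1 - k ^ 2)) := ellipticK_pos (by
    rw [Real.sq_sqrt (by linarith)]; nlinarith)
  have hτ_eq : ellipticTau k =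
      ((ellipticK (Real.sqrt (1 - k ^ 2)) / ellipticK k : ℝ) : ℂ) * I := by
    rw [ellipticTau]; push_cast; ring
  have hτ : 0 < (ellipticTau k).im := by
    rw [hτ_eq]; simpa using div_pos hK'pos hKpos
  have hre : (ellipticTau k).re = 0 := by rw [hτ_eq]; simp
  have h2 := theta2_zero_ne_zero hτ hre
  have h3 := theta3_zero_ne_zero hτ hre
  have h4 := theta4_zero_ne_zero hτ hre
  have hcn0 : jacobiCN k 0 = 1 := by
    rw [jacobiCN, zero_div, mul_comm, div_self (mul_ne_zero h2 h4)]
  have hdn0 : jacobiDN k 0 = 1 := by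
    rw [jacobiDN, zero_div, mul_comm, div_self (mul_ne_zero h3 h4)]
  have hsn0 : jacobiSN k 0 = 0 := by
    rw [jacobiSN, zero_div, theta1_zero, mul_zero, zero_div]
  have e1 : (4 * ellipticK k : ℂ) = 2 * (2 * ellipticK k) := by ring
  have e2 : 4 * I * (ellipticK (Real.sqrt (1 - k ^ 2)) : ℂ) =
    2 * (2 * I * ellipticK (Real.sqrt (1 - k ^ 2))) := by ring
  ext ω
  simp only [Set.mem_ofPred_eq, SetLike.mem_coe]
  constructor
  · rintro ⟨hsn, hcn, hdn⟩
    have hcω : jacobiCN k ω = 1 := hcn.eq.trans hcn0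
    have hdω : jacobiDN k ω = 1 := hdn.eq.trans hdn0
    have hsω : jacobiSN k ω = 0 := hsn.eq.trans hsn0
    -- The totalised quotient vanishes at poles, so `cn ω = 1` shows that `ω` is not a pole.
    have h4ω : theta4 (ω / (2 * ellipticK k)) (ellipticTau k) ≠ 0 := by
      intro h0
      rw [jacobiCN, h0, mul_zero, div_zero] at hcω
      exact zero_ne_one hcω
    have h1ω : theta1 (ω / (2 * ellipticK k)) (ellipticTau k) = 0 := by
      rw [jacobiSN, div_eq_zero_iff, mul_eq_zero] at hsω
      exact (hsω.resolve_right (mul_ne_zero h2 h4ω)).resolve_left h3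
    obtain ⟨m, n, hmn⟩ := exists_int_of_theta1_eq_zero hτ h1ω
    have hω : ω = m * (2 * ellipticK k) + n * (2 * I * ellipticK (Real.sqrt (1 - k ^ 2))) := by
      rw [div_eq_iff (by simpa using hKC)] at hmn
      rw [hmn, ellipticTau]
      field_simp
    have hn : Even n := by
      by_contra hodd
      have h := Function.Antiperiodic.add_int_mul_eq (α := ℂ) (β := ℂ)
        (jacobiDN_antiperiodic_imag hK) (x := m * (2 * ellipticK k)) n
      rw [← hω, hdω, ((jacobiDN_periodic hK).int_mul m).eq, hdn0,
        Int.negOnePow_odd n (Int.not_even_iff_odd.mp hodd)] at h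
      norm_num at h
    have hm : Even m := by
      by_contra hodd
      have h := Function.Antiperiodic.add_int_mul_eq (α := ℂ) (β := ℂ)
        (jacobiCN_antiperiodic_imag hK) (x := m * (2 * ellipticK k)) n
      have h' := Function.Antiperiodic.add_int_mul_eq (α := ℂ) (β := ℂ)
        (jacobiCN_antiperiodic hK) (x := 0) m
      rw [← hω, hcω, Int.negOnePow_even n hn] at h
      rw [zero_add, hcn0, Int.negOnePow_odd m (Int.not_even_iff_odd.mp hodd)] at h'
      rw [h'] at h
      norm_num at h
    obtain ⟨a, rfl⟩ := hm
    obtain ⟨b, rfl⟩ := hn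
    rw [AddSubgroup.mem_closure_pair]
    refine ⟨a, b, ?_⟩
    rw [hω]
    simp only [zsmul_eq_mul]
    push_cast
    ring
  · intro hω
    induction hω using AddSubgroup.closure_induction with
    | mem x hx =>
      rcases hx with rfl | rfl
      · rw [e1]
        exact ⟨(jacobiSN_antiperiodic hK).periodic_two_mul,
          (jacobiCN_antiperiodic hK).periodic_two_mul,
          by simpa using (jacobiDN_periodic hK).nat_mul 2⟩
      · rw [e2]
        exact ⟨by simpa using (jacobiSN_periodic_imag hK).nat_mul 2,
          (jacobiCN_antiperiodic_imag hK).periodic_two_mul,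
          (jacobiDN_antiperiodic_imag hK).periodic_two_mul⟩
    | zero => simp [Function.Periodic]
    | add x y _ _ hx hy =>
      exact ⟨hx.1.add_period hy.1, hx.2.1.add_period hy.2.1, hx.2.2.add_period hy.2.2⟩
    | neg x _ hx => exact ⟨hx.1.neg, hx.2.1.neg, hx.2.2.neg⟩

end Periods

/-! ### Gauss's integral and the Landen transformation for real arguments -/

/-- Gauss's integral `∫ dθ / √(a² cos² θ + b² sin² θ)` over `[0, π/2]`, which is invariant under the
arithmetic-geometric mean step and equals `π / (2 AGM(a, b))`. -/
noncomputable def gaussIntegral (a b : ℝ) : ℝ :=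
  ∫ θ in (0 : ℝ)..(Real.pi / 2), 1 / Real.sqrt (a ^ 2 * Real.cos θ ^ 2 + b ^ 2 * Real.sin θ ^ 2)

lemma ellipticK_eq_gaussIntegral {k : ℝ} (hk : k ^ 2 ≤ 1) :
    ellipticK k = gaussIntegral 1 (Real.sqrt (1 - k ^ 2)) := by
  unfold ellipticK gaussIntegral
  refine intervalIntegral.integral_congr fun θ _ => ?_
  rw [Real.sq_sqrt (by linarith)]
  congr 2
  linear_combination -Real.sin_sq_add_cos_sq θ

lemma gaussIntegral_mul {c : ℝ} (hc : 0 < c) (a b : ℝ) :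
    gaussIntegral (c * a) (c * b) = gaussIntegral a b / c := by
  unfold gaussIntegral
  rw [← intervalIntegral.integral_div]
  refine intervalIntegral.integral_congr fun θ _ => ?_
  rw [show (c * a) ^ 2 * Real.cos θ ^ 2 + (c * b) ^ 2 * Real.sin θ ^ 2 =
      c ^ 2 * (a ^ 2 * Real.cos θ ^ 2 + b ^ 2 * Real.sin θ ^ 2) by ring,
    Real.sqrt_mul (sq_nonneg c), Real.sqrt_sq hc.le, div_div, mul_comm c]

/-- The substitution `x = b tan θ` gives Gauss's integral an algebraic integrand. -/
lemma gaussIntegral_eq_integral_Ioi (a : ℝ) {b : ℝ} (hb : 0 < b) :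
    gaussIntegral a b =
      ∫ x in Set.Ioi (0 : ℝ), 1 / Real.sqrt ((x ^ 2 + a ^ 2) * (x ^ 2 + b ^ 2)) := by
  have hcos : ∀ θ ∈ Set.Ioo 0 (Real.pi / 2), 0 < Real.cos θ := fun θ hθ =>
    Real.cos_pos_of_mem_Ioo ⟨by linarith [hθ.1, Real.pi_pos], hθ.2⟩
  have himg : (fun θ => b * Real.tan θ) '' Set.Ioo 0 (Real.pi / 2) = Set.Ioi 0 := by
    ext x
    simp only [Set.mem_image, Set.mem_Ioi]
    constructor
    · rintro ⟨θ, hθ, rfl⟩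
      exact mul_pos hb (Real.tan_pos_of_pos_of_lt_pi_div_two hθ.1 hθ.2)
    · intro hx
      refine ⟨Real.arctan (x / b), ⟨Real.arctan_pos.mpr (div_pos hx hb),
        Real.arctan_lt_pi_div_two _⟩, ?_⟩
      rw [Real.tan_arctan]
      field_simp
  have hderiv : ∀ θ ∈ Set.Ioo 0 (Real.pi / 2), HasDerivWithinAt (fun θ => b * Real.tan θ)
      (b * (1 / Real.cos θ ^ 2)) (Set.Ioo 0 (Real.pi / 2)) θ := fun θ hθ =>
    ((Real.hasDerivAt_tan (hcos θ hθ).ne').const_mul b).hasDerivWithinAt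
  have hinj : Set.InjOn (fun θ => b * Real.tan θ) (Set.Ioo 0 (Real.pi / 2)) := by
    intro x hx y hy hxy
    refine Real.injOn_tan ⟨by linarith [hx.1, Real.pi_pos], hx.2⟩
      ⟨by linarith [hy.1, Real.pi_pos], hy.2⟩ (mul_left_cancel₀ hb.ne' hxy)
  rw [← himg, MeasureTheory.integral_image_eq_integral_abs_deriv_smul measurableSet_Ioo hderiv hinj,
    gaussIntegral, intervalIntegral.integral_of_le (by positivity),
    MeasureTheory.integral_Ioc_eq_integral_Ioo]
  refine MeasureTheory.setIntegral_congr_fun measurableSet_Ioo fun θ hθ => ?_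
  have hc := hcos θ hθ
  have h1 : ((b * Real.tan θ) ^ 2 + a ^ 2) * ((b * Real.tan θ) ^ 2 + b ^ 2) =
      (b * (1 / Real.cos θ ^ 2)) ^ 2 *
        (a ^ 2 * Real.cos θ ^ 2 + b ^ 2 * Real.sin θ ^ 2) := by
    rw [Real.tan_eq_sin_div_cos]
    field_simp
    linear_combination (b ^ 2 * Real.sin θ ^ 2 + a ^ 2 * Real.cos θ ^ 2) *
      Real.sin_sq_add_cos_sq θ
  have h2 : 0 < b * (1 / Real.cos θ ^ 2) := by positivity
  simp only [smul_eq_mul]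
  rw [h1, Real.sqrt_mul (sq_nonneg _), Real.sqrt_sq h2.le, abs_of_pos h2, mul_one_div,
    div_mul_cancel_left₀ h2.ne', one_div]

/-- Invariance of Gauss's integral under the arithmetic-geometric mean step, by Newman's
substitution `t = (x - a b / x) / 2`, which maps `(0, ∞)` onto `ℝ`. -/
lemma gaussIntegral_agm_step {a b : ℝ} (ha : 0 < a) (hb : 0 < b) :
    gaussIntegral a b = gaussIntegral ((a + b) / 2) (Real.sqrt (a * b)) := by
  have hab : 0 < a * b := mul_pos ha hb
  have hG : 0 < Real.sqrt (a * b) := Real.sqrt_pos.mpr hab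
  rw [gaussIntegral_eq_integral_Ioi a hb, gaussIntegral_eq_integral_Ioi _ hG]
  set g : ℝ → ℝ := fun t => 1 / Real.sqrt ((t ^ 2 + ((a + b) / 2) ^ 2) *
    (t ^ 2 + Real.sqrt (a * b) ^ 2)) with hg
  have heven : ∫ t, g t = 2 * ∫ t in Set.Ioi 0, g t := by
    rw [← integral_comp_abs]
    simp [hg]
  have himg : (fun x => (x - a * b / x) / 2) '' Set.Ioi 0 = Set.univ := by
    refine Set.eq_univ_of_forall fun t => ?_
    have h1 : |t| < Real.sqrt (t ^ 2 + a * b) := by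
      rw [← Real.sqrt_sq_eq_abs]
      exact Real.sqrt_lt_sqrt (sq_nonneg t) (by linarith)
    have h2 : 0 < t + Real.sqrt (t ^ 2 + a * b) := by linarith [neg_abs_le t]
    refine ⟨t + Real.sqrt (t ^ 2 + a * b), h2, ?_⟩
    have h3 : Real.sqrt (t ^ 2 + a * b) ^ 2 = t ^ 2 + a * b := Real.sq_sqrt (by positivity)
    simp only
    field_simp
    linear_combination h3
  have hderiv : ∀ x ∈ Set.Ioi (0 : ℝ), HasDerivWithinAt (fun x => (x - a * b / x) / 2)
      ((1 + a * b / x ^ 2) / 2) (Set.Ioi 0) x := by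
    intro x hx
    have hx' : x ≠ 0 := (Set.mem_Ioi.mp hx).ne'
    have h := (((hasDerivAt_id x).sub ((hasDerivAt_inv hx').const_mul (a * b))).div_const 2)
    refine (h.congr_deriv ?_).hasDerivWithinAt.congr_of_eventuallyEq ?_ ?_
    · field_simp
      ring
    · exact Eventually.of_forall fun y => by simp [div_eq_mul_inv]
    · simp [div_eq_mul_inv]
  have hinj : Set.InjOn (fun x => (x - a * b / x) / 2) (Set.Ioi 0) := by
    intro x hx y hy hxy
    have hx' : 0 < x := hx
    have hy' : 0 < y := hy
    simp only at hxy
    field_simp at hxy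
    have h : (x - y) * (x * y + a * b) = 0 := by linear_combination hxy
    rcases mul_eq_zero.mp h with h | h
    · linarith
    · nlinarith [mul_pos hx' hy']
  have hcv := MeasureTheory.integral_image_eq_integral_abs_deriv_smul measurableSet_Ioi hderiv
    hinj g
  rw [himg, MeasureTheory.setIntegral_univ, heven] at hcv
  have hint : ∫ x in Set.Ioi (0 : ℝ), |(1 + a * b / x ^ 2) / 2| • g ((x - a * b / x) / 2) =
      2 * ∫ x in Set.Ioi (0 : ℝ), 1 / Real.sqrt ((x ^ 2 + a ^ 2) * (x ^ 2 + b ^ 2)) := by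
    rw [← MeasureTheory.integral_const_mul]
    refine MeasureTheory.setIntegral_congr_fun measurableSet_Ioi fun x hx => ?_
    have hx' : 0 < x := hx
    have h1 : (((x - a * b / x) / 2) ^ 2 + ((a + b) / 2) ^ 2) *
        (((x - a * b / x) / 2) ^ 2 + Real.sqrt (a * b) ^ 2) =
        ((1 + a * b / x ^ 2) / 4) ^ 2 * ((x ^ 2 + a ^ 2) * (x ^ 2 + b ^ 2)) := by
      rw [Real.sq_sqrt hab.le]
      field_simp
      ring
    have h2 : 0 < (1 + a * b / x ^ 2) / 2 := by positivity
    have h3 : 0 < (1 + a * b / x ^ 2) / 4 := by positivity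
    have h4 : 0 < Real.sqrt ((x ^ 2 + a ^ 2) * (x ^ 2 + b ^ 2)) := Real.sqrt_pos.mpr (by positivity)
    simp only [hg, smul_eq_mul]
    rw [h1, Real.sqrt_mul (sq_nonneg _), Real.sqrt_sq h3.le, abs_of_pos h2]
    field_simp
    norm_num
  rw [hint] at hcv
  linarith

/-- If `k = 2 √q / (1 + q)`, then the complementary modulus `b` is `(1 - q) / (1 + q)`. -/
lemma sqrt_one_sub_sq_landen {q : ℝ} (hq0 : 0 ≤ q) (hq1 : q ≤ 1) :
    Real.sqrt (1 - (2 * Real.sqrt q / (1 + q)) ^ 2) = (1 - q) / (1 + q) := by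
  have h : 1 - (2 * Real.sqrt q / (1 + q)) ^ 2 = ((1 - q) / (1 + q)) ^ 2 := by
    rw [div_pow, mul_pow, Real.sq_sqrt hq0]; field_simp; ring
  rw [h, Real.sqrt_sq (div_nonneg (by linarith) (by linarith))]

/-- The ascending Landen transformation. -/
lemma ellipticK_landen {k : ℝ} (hk0 : 0 ≤ k) (hk1 : k < 1) :
    ellipticK (2 * Real.sqrt k / (1 + k)) = (1 + k) * ellipticK k := by
  have hs : (2 * Real.sqrt k / (1 + k)) ^ 2 = 4 * k / (1 + k) ^ 2 := by
    rw [div_pow, mul_pow, Real.sq_sqrt hk0]; norm_num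
  have hq : 0 < 1 - k := by linarith
  have hk2 : 0 ≤ 1 - k ^ 2 := by nlinarith
  have hle : (2 * Real.sqrt k / (1 + k)) ^ 2 ≤ 1 := by
    rw [hs, div_le_one (by positivity)]
    nlinarith [sq_nonneg (1 - k)]
  rw [ellipticK_eq_gaussIntegral hle,
    sqrt_one_sub_sq_landen hk0 hk1.le, ellipticK_eq_gaussIntegral (k := k) (by linarith)]
  have h2 := gaussIntegral_mul (c := (1 + k)⁻¹) (by positivity) (1 + k) (1 - k)
  rw [inv_mul_cancel₀ (by positivity), mul_comm (1 + k)⁻¹ (1 - k), ← div_eq_mul_inv, div_inv_eq_mul,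
    gaussIntegral_agm_step (by positivity) hq] at h2
  rw [h2, show (1 + k + (1 - k)) / 2 = 1 by ring, show (1 + k) * (1 - k) = 1 - k ^ 2 by ring,
    mul_comm]

/-- The complementary modulus of `q` is the ascending Landen transform of `(1 - q) / (1 + q)`. -/
lemma landen_one_sub_div {q : ℝ} (hq0 : 0 ≤ q) :
    2 * Real.sqrt ((1 - q) / (1 + q)) / (1 + (1 - q) / (1 + q)) = Real.sqrt (1 - q ^ 2) := by
  have h : (1 - q) / (1 + q) = (1 - q ^ 2) / (1 + q) ^ 2 := by field_simp; ring
  rw [h, Real.sqrt_div' _ (by positivity), Real.sqrt_sq (by positivity), ← h]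
  field_simp
  ring

theorem ellipticK_double_landen {k b q v c w : ℝ} (hb : b = Real.sqrt (1 - k ^ 2)) (hq0 : 0 < q)
    (hq1 : q < 1) (hc0 : 0 < c) (hc1 : c < 1) (hk : k = 2 * Real.sqrt q / (1 + q))
    (hv : v = Real.sqrt (1 - q ^ 2)) (hq : q = 2 * Real.sqrt c / (1 + c))
    (hw : w = 2 * Real.sqrt v / (1 + v)) :
    ellipticK k = 2 / (1 + b) * (2 / (1 + v)) * ellipticK c ∧
      ellipticK w = 2 / (1 + c) * (2 / (1 + q)) * ellipticK b ∧
      ellipticK k * ellipticK w = 4 * ellipticK b * ellipticK c := by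
  have hbq : b = (1 - q) / (1 + q) := by rw [hb, hk, sqrt_one_sub_sq_landen hq0.le hq1.le]
  have hvc : v = (1 - c) / (1 + c) := by rw [hv, hq, sqrt_one_sub_sq_landen hc0.le hc1.le]
  have hv0 : 0 < v := by rw [hvc]; exact div_pos (by linarith) (by linarith)
  have hv1 : v < 1 := by rw [hvc, div_lt_one (by linarith)]; linarith
  have hb0 : 0 < b := by rw [hbq]; exact div_pos (by linarith) (by linarith)
  have hb1 : b < 1 := by rw [hbq, div_lt_one (by linarith)]; linarith
  have hvb : v = 2 * Real.sqrt b / (1 + b) := by rw [hv, hbq, landen_one_sub_div hq0.le]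
  have h1 : 1 + b = 2 / (1 + q) := by rw [hbq]; field_simp; ring
  have h2 : 1 + v = 2 / (1 + c) := by rw [hvc]; field_simp; ring
  have hKk : ellipticK k = (1 + q) * ((1 + c) * ellipticK c) := by
    rw [hk, ellipticK_landen hq0.le hq1]
    congr 1
    rw [hq, ellipticK_landen hc0.le hc1]
  have hKw : ellipticK w = (1 + v) * ((1 + b) * ellipticK b) := by
    rw [hw, ellipticK_landen hv0.le hv1]
    congr 1
    rw [hvb, ellipticK_landen hb0.le hb1]
  rw [hKk, hKw, h1, h2]
  refine ⟨?_, ?_, ?_⟩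
  · field_simp
  · field_simp
  · field_simp
    ring

/-! ### Gauss's integral for complex arguments -/

/-- The quadratic form `cos² θ + z² sin² θ` under the root in Gauss's integral. -/
noncomputable def gaussForm (z : ℂ) (θ : ℝ) : ℂ := Real.cos θ ^ 2 + z ^ 2 * Real.sin θ ^ 2

/-- Gauss's integral with parameters `1` and `z`, for complex `z`; it is holomorphic on the right
half-plane, where the principal branch of the root is never evaluated on its cut. -/
noncomputable def complexGauss (z : ℂ) : ℂ :=
  ∫ θ in (0 : ℝ)..(Real.pi / 2), gaussForm z θ ^ (-(1 / 2) : ℂ)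

lemma gaussForm_re (z : ℂ) (θ : ℝ) :
    (gaussForm z θ).re = Real.cos θ ^ 2 + (z.re ^ 2 - z.im ^ 2) * Real.sin θ ^ 2 := by
  simp [gaussForm, pow_two, -ofReal_cos, -ofReal_sin]

lemma gaussForm_im (z : ℂ) (θ : ℝ) :
    (gaussForm z θ).im = 2 * z.re * z.im * Real.sin θ ^ 2 := by
  simp [gaussForm, pow_two, -ofReal_cos, -ofReal_sin]
  left
  ring

lemma gaussForm_mem_slitPlane {z : ℂ} (hz : 0 < z.re) (θ : ℝ) : gaussForm z θ ∈ slitPlane := by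
  rw [mem_slitPlane_iff, gaussForm_re, gaussForm_im]
  by_cases hs : Real.sin θ = 0
  · left
    have := Real.sin_sq_add_cos_sq θ
    rw [hs] at this ⊢
    nlinarith
  by_cases hi : z.im = 0
  · left
    rw [hi]
    have : 0 < Real.sin θ ^ 2 := by positivity
    have : 0 < z.re ^ 2 := by positivity
    nlinarith [mul_pos ‹0 < Real.sin θ ^ 2› this, sq_nonneg (Real.cos θ)]
  · right
    positivity

lemma continuous_gaussForm : Continuous fun p : ℂ × ℝ => gaussForm p.1 p.2 := by
  unfold gaussForm
  fun_prop

lemma continuous_gaussForm_cpow {z : ℂ} (hz : 0 < z.re) (s : ℂ) :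
    Continuous fun θ : ℝ => gaussForm z θ ^ s :=
  (continuous_gaussForm.comp (Continuous.prodMk_right z)).cpow continuous_const
    fun θ => gaussForm_mem_slitPlane hz θ

lemma differentiableAt_complexGauss {z₀ : ℂ} (hz₀ : 0 < z₀.re) :
    DifferentiableAt ℂ complexGauss z₀ := by
  set F' : ℂ → ℝ → ℂ := fun z θ =>
    -(1 / 2) * gaussForm z θ ^ (-(1 / 2) - 1 : ℂ) * (2 * z * Real.sin θ ^ 2) with hF'
  have hball : ∀ z ∈ Metric.closedBall z₀ (z₀.re / 2), 0 < z.re := by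
    intro z hz
    have h := (abs_re_le_norm (z - z₀)).trans (mem_closedBall_iff_norm.mp hz)
    rw [sub_re, abs_le] at h
    linarith [h.1]
  have hcont : ContinuousOn (fun p : ℂ × ℝ => F' p.1 p.2)
      (Metric.closedBall z₀ (z₀.re / 2) ×ˢ Set.Icc 0 (Real.pi / 2)) := by
    refine (ContinuousOn.mul continuousOn_const (continuous_gaussForm.continuousOn.cpow_const
      fun p hp => gaussForm_mem_slitPlane (hball p.1 hp.1) p.2)).mul (Continuous.continuousOn ?_)
    fun_prop
  obtain ⟨C, hC⟩ := ((isCompact_closedBall z₀ (z₀.re / 2)).prod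
    isCompact_Icc).exists_bound_of_continuousOn hcont
  have hI : Set.uIoc 0 (Real.pi / 2) ⊆ Set.Icc 0 (Real.pi / 2) := by
    rw [Set.uIoc_of_le (by positivity)]
    exact Set.Ioc_subset_Icc_self
  refine (intervalIntegral.hasDerivAt_integral_of_dominated_loc_of_deriv_le (F' := F')
    (bound := fun _ => C) (Metric.ball_mem_nhds z₀ (half_pos hz₀)) ?_ ?_ ?_ ?_ ?_
    ?_).2.differentiableAt
  · filter_upwards [Metric.ball_mem_nhds z₀ (half_pos hz₀)] with z hz
    exact (continuous_gaussForm_cpow (hball z (Metric.ball_subset_closedBall hz))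
      _).aestronglyMeasurable
  · exact (continuous_gaussForm_cpow hz₀ _).intervalIntegrable _ _
  · have h1 := continuous_gaussForm_cpow hz₀ (-(1 / 2) - 1 : ℂ)
    exact (show Continuous (F' z₀) by fun_prop).aestronglyMeasurable
  · exact Eventually.of_forall fun θ hθ z hz =>
      hC (z, θ) ⟨Metric.ball_subset_closedBall hz, hI hθ⟩
  · exact intervalIntegrable_const
  · refine Eventually.of_forall fun θ _ z hz => ?_
    have h : HasDerivAt (fun z => gaussForm z θ) (2 * z * Real.sin θ ^ 2) z := by
      have := ((hasDerivAt_pow 2 z).mul_const ((Real.sin θ : ℂ) ^ 2)).const_add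
        ((Real.cos θ : ℂ) ^ 2)
      simpa [gaussForm] using! this
    exact h.cpow_const (gaussForm_mem_slitPlane (hball z (Metric.ball_subset_closedBall hz)) θ)

lemma ofReal_cpow_neg_half (h : ℝ) :
    (h : ℂ) ^ (-(1 / 2) : ℂ) =
      ((1 / Real.sqrt h : ℝ) : ℂ) - I * ((1 / Real.sqrt (-h) : ℝ) : ℂ) := by
  have hpos : ∀ x : ℝ, 0 ≤ x → (x : ℂ) ^ (-(1 / 2) : ℂ) = ((1 / Real.sqrt x : ℝ) : ℂ) := by
    intro x hx
    rw [one_div (Real.sqrt x), Real.sqrt_eq_rpow, ← Real.rpow_neg hx, ofReal_cpow hx]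
    norm_num
  rcases le_total 0 h with h0 | h0
  · rw [hpos h h0, Real.sqrt_eq_zero_of_nonpos (by linarith : -h ≤ 0)]
    simp
  · rw [ofReal_cpow_of_nonpos h0, ← ofReal_neg, hpos _ (by linarith),
      Real.sqrt_eq_zero_of_nonpos h0,
      show (Real.pi : ℂ) * I * (-(1 / 2)) = -(Real.pi / 2 * I) by ring, Complex.exp_neg,
      exp_pi_div_two_mul_I, inv_I]
    simp
    ring

lemma complexGauss_ofReal {x : ℝ} : complexGauss x = gaussIntegral 1 x := by
  unfold complexGauss gaussIntegral
  rw [← intervalIntegral.integral_ofReal]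
  refine intervalIntegral.integral_congr fun θ _ => ?_
  have h : gaussForm x θ = ((1 ^ 2 * Real.cos θ ^ 2 + x ^ 2 * Real.sin θ ^ 2 : ℝ) : ℂ) := by
    simp [gaussForm]
  have h0 : Real.sqrt (-(1 ^ 2 * Real.cos θ ^ 2 + x ^ 2 * Real.sin θ ^ 2)) = 0 :=
    Real.sqrt_eq_zero_of_nonpos (by nlinarith [sq_nonneg (Real.cos θ), sq_nonneg (x * Real.sin θ)])
  rw [h, ofReal_cpow_neg_half, h0]
  simp

lemma complexGauss_one : complexGauss 1 = Real.pi / 2 := by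
  have h := complexGauss_ofReal (x := 1)
  rw [ofReal_one] at h
  rw [h, gaussIntegral]
  simp

lemma complexGauss_conj {z : ℂ} (hz : 0 < z.re) :
    complexGauss (starRingEnd ℂ z) = starRingEnd ℂ (complexGauss z) := by
  unfold complexGauss
  simp only [intervalIntegral.integral_of_le (show (0 : ℝ) ≤ Real.pi / 2 by positivity)]
  rw [← integral_conj]
  refine MeasureTheory.setIntegral_congr_fun measurableSet_Ioc fun θ _ => ?_
  have h1 : gaussForm (starRingEnd ℂ z) θ = starRingEnd ℂ (gaussForm z θ) := by
    simp [gaussForm, -ofReal_cos, -ofReal_sin]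
  rw [h1, conj_cpow _ _ (slitPlane_arg_ne_pi (gaussForm_mem_slitPlane hz θ))]
  simp [map_ofNat]

/-- The ratio `√(a g) / ((a + g) / 2)` of the near root to the arithmetic mean, as a function of
`z = g / a`. -/
noncomputable def agmRatio (z : ℂ) : ℂ := 2 * z ^ (1 / 2 : ℂ) / (1 + z)

lemma cpow_half_sq (z : ℂ) : (z ^ (1 / 2 : ℂ)) ^ 2 = z := by
  rw [← cpow_nat_mul]; simp

lemma cpow_half_re_pos {z : ℂ} (hz : z ∈ slitPlane) : 0 < (z ^ (1 / 2 : ℂ)).re := by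
  rw [cpow_def_of_ne_zero (slitPlane_ne_zero hz), exp_re]
  refine mul_pos (Real.exp_pos _) (Real.cos_pos_of_mem_Ioo ?_)
  have h1 : (log z * (1 / 2)).im = arg z / 2 := by
    rw [show log z * (1 / 2) = log z / (2 : ℝ) by push_cast; ring, div_ofReal_im, log_im]
  rw [h1]
  constructor
  · linarith [neg_pi_lt_arg z]
  · linarith [(arg_le_pi z).lt_of_ne (slitPlane_arg_ne_pi hz)]

lemma one_add_ne_zero_of_mem_slitPlane {z : ℂ} (hz : z ∈ slitPlane) : 1 + z ≠ 0 := by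
  intro h
  rw [← neg_eq_of_add_eq_zero_right h, mem_slitPlane_iff] at hz
  norm_num at hz

lemma div_re_pos_iff {z w : ℂ} (hw : w ≠ 0) : 0 < (z / w).re ↔ 0 < z.re * w.re + z.im * w.im := by
  rw [div_re, ← add_div, div_pos_iff_of_pos_right (normSq_pos.mpr hw)]

/-- With `s = √z` one has `Re (s / (1 + s²)) = (1 + |s|²) Re s / |1 + s²|²`, which is positive: on
the slit plane the principal root selects the near root. -/
lemma agmRatio_re_pos {z : ℂ} (hz : z ∈ slitPlane) : 0 < (agmRatio z).re := by
  have hs := cpow_half_re_pos hz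
  have hsq := cpow_half_sq z
  have h1 := one_add_ne_zero_of_mem_slitPlane hz
  rw [agmRatio, div_re_pos_iff h1]
  set s := z ^ (1 / 2 : ℂ)
  rw [← hsq]
  simp [pow_two]
  nlinarith [mul_pos hs hs, mul_nonneg hs.le (sq_nonneg s.im), mul_nonneg hs.le (sq_nonneg s.re)]

lemma agmRatio_conj {z : ℂ} (hz : z ∈ slitPlane) :
    agmRatio (starRingEnd ℂ z) = starRingEnd ℂ (agmRatio z) := by
  rw [agmRatio, agmRatio, conj_cpow _ _ (slitPlane_arg_ne_pi hz)]
  simp [map_ofNat]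

lemma differentiableAt_agmRatio {z : ℂ} (hz : z ∈ slitPlane) : DifferentiableAt ℂ agmRatio z :=
  ((DifferentiableAt.cpow_const (c := (1 / 2 : ℂ)) differentiableAt_fun_id hz).const_mul 2).div
    (differentiableAt_id.const_add 1) (one_add_ne_zero_of_mem_slitPlane hz)

lemma mem_slitPlane_of_re_pos {z : ℂ} (hz : 0 < z.re) : z ∈ slitPlane :=
  mem_slitPlane_iff.mpr (Or.inl hz)

/-- Gauss's integral after one arithmetic-geometric mean step, as a function of the ratio `z` of the
initial values. It is defined on the whole slit plane. -/
noncomputable def complexGaussStep (z : ℂ) : ℂ := 2 / (1 + z) * complexGauss (agmRatio z)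

lemma differentiableAt_complexGaussStep {z : ℂ} (hz : z ∈ slitPlane) :
    DifferentiableAt ℂ complexGaussStep z :=
  ((differentiableAt_const 2).div (differentiableAt_id.const_add 1)
    (one_add_ne_zero_of_mem_slitPlane hz)).mul
    (DifferentiableAt.fun_comp' z (differentiableAt_complexGauss (agmRatio_re_pos hz))
      (differentiableAt_agmRatio hz))

lemma complexGaussStep_conj {z : ℂ} (hz : z ∈ slitPlane) :
    complexGaussStep (starRingEnd ℂ z) = starRingEnd ℂ (complexGaussStep z) := by
  rw [complexGaussStep, complexGaussStep, agmRatio_conj hz, complexGauss_conj (agmRatio_re_pos hz)]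
  simp [map_ofNat]

lemma complexGauss_eq_step_ofReal {x : ℝ} (hx : 0 < x) :
    complexGauss x = complexGaussStep x := by
  have h1 : agmRatio x = ((2 * Real.sqrt x / (1 + x) : ℝ) : ℂ) := by
    rw [agmRatio, show (1 / 2 : ℂ) = ((1 / 2 : ℝ) : ℂ) by norm_num, ← ofReal_cpow hx.le,
      ← Real.sqrt_eq_rpow]
    push_cast
    ring
  have h2 : gaussIntegral 1 x = 2 / (1 + x) * gaussIntegral 1 (2 * Real.sqrt x / (1 + x)) := by
    have h := gaussIntegral_mul (c := (1 + x) / 2) (by positivity) 1 (2 * Real.sqrt x / (1 + x))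
    rw [mul_one, show (1 + x) / 2 * (2 * Real.sqrt x / (1 + x)) = Real.sqrt (1 * x) by
      rw [one_mul]; field_simp] at h
    rw [gaussIntegral_agm_step one_pos hx, h]
    field_simp
  rw [complexGaussStep, h1, complexGauss_ofReal, complexGauss_ofReal, h2]
  push_cast
  ring

/-- Invariance of the complex Gauss integral under the arithmetic-geometric mean step, by analytic
continuation from the positive reals. -/
lemma complexGauss_eq_step {z : ℂ} (hz : 0 < z.re) : complexGauss z = complexGaussStep z := by
  have hopen : IsOpen {z : ℂ | 0 < z.re} := isOpen_lt continuous_const continuous_re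
  refine AnalyticOnNhd.eqOn_of_preconnected_of_frequently_eq (U := {z : ℂ | 0 < z.re}) (z₀ := 1)
    (DifferentiableOn.analyticOnNhd (fun w hw =>
      (differentiableAt_complexGauss hw).differentiableWithinAt) hopen)
    (DifferentiableOn.analyticOnNhd (fun w hw => (differentiableAt_complexGaussStep
      (mem_slitPlane_of_re_pos hw)).differentiableWithinAt) hopen)
    (convex_halfSpace_re_gt 0).isPreconnected (by simp) ?_ hz
  have htend : Tendsto (fun x : ℝ => (x : ℂ)) (𝓝[>] 1) (𝓝[≠] 1) := by
    refine tendsto_nhdsWithin_iff.mpr ⟨?_, ?_⟩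
    · exact (continuous_ofReal.tendsto' 1 1 (by simp)).mono_left nhdsWithin_le_nhds
    · filter_upwards [self_mem_nhdsWithin] with x hx
      have : (1 : ℝ) < x := hx
      simpa using this.ne'
  refine htend.frequently (Eventually.frequently ?_)
  filter_upwards [self_mem_nhdsWithin] with x hx
  exact complexGauss_eq_step_ofReal (zero_lt_one.trans hx)

/-! ### The boundary values of Gauss's integral on the imaginary axis -/

/-- The part of the indefinite integral where the form is positive, by the substitution
`c sin θ = a sin φ` with `c² = a² + g²`. Where the form is negative the root, and hence the
integrand, is `0` by convention. -/
lemma integral_indefinite_form {a g : ℝ} (ha : 0 < a) (hg : 0 < g) :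
    IntervalIntegrable (fun θ => 1 / Real.sqrt (a ^ 2 * Real.cos θ ^ 2 - g ^ 2 * Real.sin θ ^ 2))
        MeasureTheory.volume 0 (Real.pi / 2) ∧
      ∫ θ in (0 : ℝ)..(Real.pi / 2),
          1 / Real.sqrt (a ^ 2 * Real.cos θ ^ 2 - g ^ 2 * Real.sin θ ^ 2) =
        gaussIntegral (Real.sqrt (a ^ 2 + g ^ 2)) g := by
  have hpi := Real.pi_pos
  set c := Real.sqrt (a ^ 2 + g ^ 2) with hc
  have hcpos : 0 < c := Real.sqrt_pos.mpr (by positivity)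
  have hc2 : c ^ 2 = a ^ 2 + g ^ 2 := Real.sq_sqrt (by positivity)
  have hac : a < c := by
    rw [hc]; exact Real.lt_sqrt_of_sq_lt (by nlinarith)
  obtain ⟨s, hs⟩ : ∃ s, s = a / c := ⟨_, rfl⟩
  have hs0 : 0 < s := hs ▸ div_pos ha hcpos
  have hs1 : s < 1 := by rw [hs, div_lt_one hcpos]; exact hac
  have hcs : c * s = a := by rw [hs]; field_simp
  set G : ℝ → ℝ := fun θ => 1 / Real.sqrt (a ^ 2 * Real.cos θ ^ 2 - g ^ 2 * Real.sin θ ^ 2) with hG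
  set S := Set.Ioo 0 (Real.pi / 2) with hS
  have hsin : ∀ φ ∈ S, 0 < Real.sin φ := fun φ hφ =>
    Real.sin_pos_of_pos_of_lt_pi hφ.1 (by linarith [hφ.2])
  have hsin1 : ∀ φ ∈ S, Real.sin φ < 1 := fun φ hφ => by
    rw [← Real.sin_pi_div_two]
    exact Real.sin_lt_sin_of_lt_of_le_pi_div_two (by linarith [hφ.1]) le_rfl hφ.2
  have hcos : ∀ φ ∈ S, 0 < Real.cos φ := fun φ hφ =>
    Real.cos_pos_of_mem_Ioo ⟨by linarith [hφ.1], hφ.2⟩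
  have hss0 : ∀ φ ∈ S, 0 < s * Real.sin φ := fun φ hφ => mul_pos hs0 (hsin φ hφ)
  have hss1 : ∀ φ ∈ S, s * Real.sin φ < s := fun φ hφ => by nlinarith [hsin1 φ hφ]
  have himg : (fun φ => Real.arcsin (s * Real.sin φ)) '' S = Set.Ioo 0 (Real.arcsin s) := by
    ext θ
    constructor
    · rintro ⟨φ, hφ, rfl⟩
      exact ⟨Real.arcsin_pos.mpr (hss0 φ hφ), Real.arcsin_lt_arcsin (by linarith [hss0 φ hφ])
        (hss1 φ hφ) hs1.le⟩
    · rintro ⟨h0, h1⟩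
      have hθ2 : θ < Real.pi / 2 := h1.trans_le (Real.arcsin_le_pi_div_two s)
      have hsθ : 0 < Real.sin θ := Real.sin_pos_of_pos_of_lt_pi h0 (by linarith)
      have hsθ' : Real.sin θ < s := by
        rw [← Real.sin_arcsin (by linarith) hs1.le]
        exact Real.sin_lt_sin_of_lt_of_le_pi_div_two (by linarith) (Real.arcsin_le_pi_div_two s) h1
      have h2 : Real.sin θ / s < 1 := (div_lt_one hs0).mpr hsθ'
      have h3 : 0 < Real.sin θ / s := div_pos hsθ hs0
      refine ⟨Real.arcsin (Real.sin θ / s), ⟨Real.arcsin_pos.mpr h3,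
        Real.arcsin_lt_pi_div_two.mpr h2⟩, ?_⟩
      simp only
      rw [Real.sin_arcsin (by linarith) h2.le, mul_div_cancel₀ _ hs0.ne',
        Real.arcsin_sin (by linarith) hθ2.le]
  have hderiv : ∀ φ ∈ S, HasDerivWithinAt (fun φ => Real.arcsin (s * Real.sin φ))
      (1 / Real.sqrt (1 - (s * Real.sin φ) ^ 2) * (s * Real.cos φ)) S φ := fun φ hφ =>
    ((Real.hasDerivAt_arcsin (by linarith [hss0 φ hφ]) (by linarith [hss1 φ hφ])).comp φ
      ((Real.hasDerivAt_sin φ).const_mul s)).hasDerivWithinAt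
  have hinj : Set.InjOn (fun φ => Real.arcsin (s * Real.sin φ)) S := by
    intro x hx y hy hxy
    have h1 := Real.injOn_arcsin ⟨by linarith [hss0 x hx], by linarith [hss1 x hx]⟩
      ⟨by linarith [hss0 y hy], by linarith [hss1 y hy]⟩ hxy
    exact Real.injOn_sin ⟨by linarith [hx.1], hx.2.le⟩ ⟨by linarith [hy.1], hy.2.le⟩
      (mul_left_cancel₀ hs0.ne' h1)
  have hcongr : Set.EqOn
      (fun φ => |1 / Real.sqrt (1 - (s * Real.sin φ) ^ 2) * (s * Real.cos φ)| •
        G (Real.arcsin (s * Real.sin φ)))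
      (fun φ => 1 / Real.sqrt (c ^ 2 * Real.cos φ ^ 2 + g ^ 2 * Real.sin φ ^ 2)) S := by
    intro φ hφ
    have h0 := hss0 φ hφ
    have h1 := hss1 φ hφ
    have hcφ := hcos φ hφ
    have h2 : 0 < 1 - (s * Real.sin φ) ^ 2 := by nlinarith
    have h3 : a ^ 2 * Real.cos (Real.arcsin (s * Real.sin φ)) ^ 2 -
        g ^ 2 * Real.sin (Real.arcsin (s * Real.sin φ)) ^ 2 = (a * Real.cos φ) ^ 2 := by
      rw [Real.cos_arcsin, Real.sq_sqrt h2.le, Real.sin_arcsin (by linarith) (by linarith)]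
      have : c ^ 2 * s ^ 2 = a ^ 2 := by rw [← mul_pow, hcs]
      linear_combination (-s ^ 2 * Real.sin φ ^ 2) * hc2.symm - Real.sin φ ^ 2 * this -
        a ^ 2 * Real.sin_sq_add_cos_sq φ
    have h4 : c ^ 2 * Real.cos φ ^ 2 + g ^ 2 * Real.sin φ ^ 2 =
        c ^ 2 * (1 - (s * Real.sin φ) ^ 2) := by
      have : c ^ 2 * s ^ 2 = a ^ 2 := by rw [← mul_pow, hcs]
      linear_combination c ^ 2 * Real.sin_sq_add_cos_sq φ - Real.sin φ ^ 2 * hc2 +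
        Real.sin φ ^ 2 * this
    have h5 := Real.sqrt_pos.mpr h2
    simp only [hG, smul_eq_mul]
    rw [h3, h4, Real.sqrt_sq (by positivity), Real.sqrt_mul (sq_nonneg c), Real.sqrt_sq hcpos.le,
      abs_of_pos (by positivity), ← hcs]
    field_simp
  have hsub : Set.Ioo 0 (Real.arcsin s) ⊆ S := fun θ hθ =>
    ⟨hθ.1, hθ.2.trans_le (Real.arcsin_le_pi_div_two s)⟩
  have hzero : ∀ θ ∈ S \ Set.Ioo 0 (Real.arcsin s), G θ = 0 := by
    rintro θ ⟨hθ, hθ'⟩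
    have h1 : Real.arcsin s ≤ θ := not_lt.mp fun h => hθ' ⟨hθ.1, h⟩
    have h2 : s ≤ Real.sin θ := (Real.arcsin_le_iff_le_sin ⟨by linarith, hs1.le⟩
      ⟨by linarith [hθ.1], hθ.2.le⟩).mp h1
    have h3 : a ^ 2 * Real.cos θ ^ 2 - g ^ 2 * Real.sin θ ^ 2 ≤ 0 := by
      have h4 : a ≤ c * Real.sin θ := by rw [← hcs]; gcongr
      have h5 : a ^ 2 ≤ (c * Real.sin θ) ^ 2 := by gcongr
      rw [mul_pow, hc2] at h5
      nlinarith [Real.sin_sq_add_cos_sq θ]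
    simp only [hG]
    rw [Real.sqrt_eq_zero_of_nonpos h3, div_zero]
  have hcont : Continuous fun φ : ℝ =>
      1 / Real.sqrt (c ^ 2 * Real.cos φ ^ 2 + g ^ 2 * Real.sin φ ^ 2) := by
    refine continuous_const.div (by fun_prop) fun φ => (Real.sqrt_pos.mpr ?_).ne'
    have : c ^ 2 * Real.cos φ ^ 2 + g ^ 2 * Real.sin φ ^ 2 = g ^ 2 + a ^ 2 * Real.cos φ ^ 2 := by
      linear_combination Real.cos φ ^ 2 * hc2 + g ^ 2 * Real.sin_sq_add_cos_sq φ
    rw [this]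
    positivity
  have hintT : MeasureTheory.IntegrableOn G (Set.Ioo 0 (Real.arcsin s)) := by
    rw [← himg, MeasureTheory.integrableOn_image_iff_integrableOn_abs_deriv_smul measurableSet_Ioo
      hderiv hinj, MeasureTheory.integrableOn_congr_fun hcongr measurableSet_Ioo]
    exact (hcont.integrableOn_Icc).mono_set Set.Ioo_subset_Icc_self
  constructor
  · rw [intervalIntegrable_iff_integrableOn_Ioo_of_le (by positivity)]
    exact hintT.of_forall_sdiff_eq_zero measurableSet_Ioo hzero
  · rw [gaussIntegral, intervalIntegral.integral_of_le (by positivity),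
      intervalIntegral.integral_of_le (by positivity),
      MeasureTheory.integral_Ioc_eq_integral_Ioo, MeasureTheory.integral_Ioc_eq_integral_Ioo,
      ← MeasureTheory.setIntegral_congr_fun measurableSet_Ioo hcongr,
      ← MeasureTheory.integral_image_eq_integral_abs_deriv_smul measurableSet_Ioo hderiv hinj, himg]
    exact MeasureTheory.setIntegral_eq_of_subset_of_forall_sdiff_eq_zero measurableSet_Ioo hsub
      hzero

/-- The part of the indefinite integral where the form is negative, obtained from
`integral_indefinite_form` by the reflection `θ ↦ π / 2 - θ`. -/
lemma integral_neg_indefinite_form {a g : ℝ} (ha : 0 < a) (hg : 0 < g) :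
    IntervalIntegrable
        (fun θ => 1 / Real.sqrt (-(a ^ 2 * Real.cos θ ^ 2 - g ^ 2 * Real.sin θ ^ 2)))
        MeasureTheory.volume 0 (Real.pi / 2) ∧
      ∫ θ in (0 : ℝ)..(Real.pi / 2),
          1 / Real.sqrt (-(a ^ 2 * Real.cos θ ^ 2 - g ^ 2 * Real.sin θ ^ 2)) =
        gaussIntegral (Real.sqrt (a ^ 2 + g ^ 2)) a := by
  obtain ⟨h1, h2⟩ := integral_indefinite_form hg ha
  have h3 := h1.comp_sub_left (Real.pi / 2)
  have h4 := intervalIntegral.integral_comp_sub_left (a := 0) (b := Real.pi / 2)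
    (fun θ => 1 / Real.sqrt (g ^ 2 * Real.cos θ ^ 2 - a ^ 2 * Real.sin θ ^ 2)) (Real.pi / 2)
  simp only [Real.cos_pi_div_two_sub, Real.sin_pi_div_two_sub, sub_self, sub_zero] at h3 h4
  simp only [neg_sub]
  rw [add_comm (a ^ 2), ← h2]
  exact ⟨h3.symm, h4⟩

lemma norm_cpow_neg_half (u : ℂ) : ‖u ^ (-(1 / 2) : ℂ)‖ = 1 / Real.sqrt ‖u‖ := by
  rw [show (-(1 / 2) : ℂ) = ((-(1 / 2) : ℝ) : ℂ) by norm_num, norm_cpow_real,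
    Real.rpow_neg (norm_nonneg u), Real.sqrt_eq_rpow, ← one_div]

/-- Factoring the form as `(cos θ + i z sin θ) (cos θ - i z sin θ)` and taking real parts shows that
its modulus is smallest on the imaginary axis. -/
lemma abs_le_norm_gaussForm (x y θ : ℝ) :
    |1 ^ 2 * Real.cos θ ^ 2 - y ^ 2 * Real.sin θ ^ 2| ≤ ‖gaussForm (x + y * I) θ‖ := by
  have h1 : gaussForm (x + y * I) θ =
      ((Real.cos θ - y * Real.sin θ : ℝ) + (x * Real.sin θ : ℝ) * I) *
        ((Real.cos θ + y * Real.sin θ : ℝ) + (-(x * Real.sin θ) : ℝ) * I) := by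
    rw [gaussForm]
    push_cast
    linear_combination (x ^ 2 * sin θ ^ 2 + y ^ 2 * sin θ ^ 2) * I_sq
  have h2 : 1 ^ 2 * Real.cos θ ^ 2 - y ^ 2 * Real.sin θ ^ 2 =
      (Real.cos θ - y * Real.sin θ) * (Real.cos θ + y * Real.sin θ) := by ring
  rw [h1, h2, norm_mul, abs_mul]
  gcongr
  · simpa [-ofReal_cos, -ofReal_sin] using abs_re_le_norm
      (((Real.cos θ - y * Real.sin θ : ℝ) : ℂ) + (x * Real.sin θ : ℝ) * I)
  · simpa [-ofReal_cos, -ofReal_sin] using abs_re_le_norm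
      (((Real.cos θ + y * Real.sin θ : ℝ) : ℂ) + (-(x * Real.sin θ) : ℝ) * I)

/-- The principal power is continuous from the closed upper half-plane at every nonzero real. -/
lemma continuousWithinAt_cpow_of_im_nonneg {h : ℝ} (hh : h ≠ 0) (s : ℂ) :
    ContinuousWithinAt (fun u : ℂ => u ^ s) {u | 0 ≤ u.im} (h : ℂ) := by
  rcases hh.lt_or_gt with h0 | h0
  · have h1 := continuousWithinAt_log_of_re_neg_of_im_zero (z := h) (by simpa using h0) (by simp)
    have h2 : ContinuousWithinAt (fun u : ℂ => cexp (log u * s)) {u | 0 ≤ u.im} (h : ℂ) :=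
      (h1.mul continuousWithinAt_const).cexp
    refine h2.congr_of_eventuallyEq ?_ (cpow_def_of_ne_zero (by exact_mod_cast hh) s)
    filter_upwards [nhdsWithin_le_nhds (isOpen_ne.mem_nhds
      (show (h : ℂ) ≠ 0 by exact_mod_cast hh))] with u hu
    exact cpow_def_of_ne_zero hu s
  · exact (continuousAt_cpow_const (ofReal_mem_slitPlane.mpr h0)).continuousWithinAt

lemma ae_indefinite_form_ne_zero (y : ℝ) :
    ∀ᵐ θ : ℝ, θ ∈ Set.uIoc 0 (Real.pi / 2) →
      1 ^ 2 * Real.cos θ ^ 2 - y ^ 2 * Real.sin θ ^ 2 ≠ 0 := by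
  have hsub : {θ | θ ∈ Set.uIoc 0 (Real.pi / 2) ∧
      1 ^ 2 * Real.cos θ ^ 2 - y ^ 2 * Real.sin θ ^ 2 = 0}.Subsingleton := by
    rintro θ₁ ⟨h1, e1⟩ θ₂ ⟨h2, e2⟩
    rw [Set.uIoc_of_le (by positivity)] at h1 h2
    have hpi := Real.pi_pos
    have hs1 : 0 < Real.sin θ₁ := Real.sin_pos_of_pos_of_lt_pi h1.1 (by linarith [h1.2])
    have hs2 : 0 < Real.sin θ₂ := Real.sin_pos_of_pos_of_lt_pi h2.1 (by linarith [h2.2])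
    have hsq : (1 + y ^ 2) * (Real.sin θ₁ ^ 2) = (1 + y ^ 2) * (Real.sin θ₂ ^ 2) := by
      linear_combination e2 - e1 + Real.sin_sq_add_cos_sq θ₁ - Real.sin_sq_add_cos_sq θ₂
    have hsq' := mul_left_cancel₀ (by positivity) hsq
    exact Real.injOn_sin ⟨by linarith [h1.1], h1.2⟩ ⟨by linarith [h2.1], h2.2⟩
      ((sq_eq_sq₀ hs1.le hs2.le).mp hsq')
  filter_upwards [MeasureTheory.measure_eq_zero_iff_ae_notMem.mp
    (hsub.measure_zero MeasureTheory.volume)] with θ hθ hmem h0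
  exact hθ ⟨hmem, h0⟩

/-- The value on the imaginary axis: the real part comes from the range of `θ` where the form
`cos² θ - y² sin² θ` is positive, the imaginary part from the range where it is negative. -/
lemma complexGaussStep_mul_I {y : ℝ} (hy : 0 < y) :
    complexGaussStep (y * I) = gaussIntegral (Real.sqrt (1 + y ^ 2)) y -
      I * gaussIntegral (Real.sqrt (1 + y ^ 2)) 1 := by
  obtain ⟨hi1, he1⟩ := integral_indefinite_form one_pos hy
  obtain ⟨hi2, he2⟩ := integral_neg_indefinite_form one_pos hy
  set h : ℝ → ℝ := fun θ => 1 ^ 2 * Real.cos θ ^ 2 - y ^ 2 * Real.sin θ ^ 2 with hh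
  have hmem : (y * I : ℂ) ∈ slitPlane := mem_slitPlane_iff.mpr (Or.inr (by simpa using hy.ne'))
  have hz : Tendsto (fun x : ℝ => (x + y * I : ℂ)) (𝓝[>] 0) (𝓝 (y * I)) :=
    (Continuous.tendsto' (by fun_prop) _ _ (by simp)).mono_left nhdsWithin_le_nhds
  have hlim1 : Tendsto (fun x : ℝ => complexGauss (x + y * I)) (𝓝[>] 0)
      (𝓝 (complexGaussStep (y * I))) := by
    refine (((differentiableAt_complexGaussStep hmem).continuousAt.tendsto).comp hz).congr' ?_
    filter_upwards [self_mem_nhdsWithin] with x hx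
    exact (complexGauss_eq_step (by simpa using hx)).symm
  have hlim2 : Tendsto (fun x : ℝ => complexGauss (x + y * I)) (𝓝[>] 0)
      (𝓝 (∫ θ in (0 : ℝ)..(Real.pi / 2), ((h θ : ℝ) : ℂ) ^ (-(1 / 2) : ℂ))) := by
    refine intervalIntegral.tendsto_integral_filter_of_dominated_convergence
      (fun θ => 1 / Real.sqrt (h θ) + 1 / Real.sqrt (-h θ)) ?_ ?_ (hi1.add hi2) ?_
    · filter_upwards [self_mem_nhdsWithin] with x hx
      exact (continuous_gaussForm_cpow (by simpa using hx) _).aestronglyMeasurable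
    · refine Eventually.of_forall fun x => ?_
      filter_upwards [ae_indefinite_form_ne_zero y] with θ hθ hmem
      have hne : h θ ≠ 0 := hθ hmem
      rw [norm_cpow_neg_half]
      have hle : 1 / Real.sqrt ‖gaussForm (x + y * I) θ‖ ≤ 1 / Real.sqrt |h θ| :=
        one_div_le_one_div_of_le (Real.sqrt_pos.mpr (abs_pos.mpr hne))
          (Real.sqrt_le_sqrt (abs_le_norm_gaussForm x y θ))
      refine hle.trans ?_
      rcases abs_cases (h θ) with ⟨e, -⟩ | ⟨e, -⟩
      · rw [e]; exact le_add_of_nonneg_right (by positivity)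
      · rw [e]; exact le_add_of_nonneg_left (by positivity)
    · filter_upwards [ae_indefinite_form_ne_zero y] with θ hθ hmem
      have hne : h θ ≠ 0 := hθ hmem
      refine (continuousWithinAt_cpow_of_im_nonneg hne _).tendsto.comp
        (tendsto_nhdsWithin_iff.mpr ⟨?_, ?_⟩)
      · have hform : gaussForm (y * I) θ = (h θ : ℂ) := by
          rw [gaussForm, hh]
          push_cast
          linear_combination (y ^ 2 * sin θ ^ 2 : ℂ) * I_sq
        rw [← hform]
        exact ((continuous_gaussForm.comp (Continuous.prodMk_left θ)).tendsto (y * I)).comp hz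
      · filter_upwards [self_mem_nhdsWithin] with x hx
        have hx' : 0 < x := hx
        change 0 ≤ (gaussForm (x + y * I) θ).im
        rw [gaussForm_im]
        simp only [add_re, ofReal_re, mul_re, I_re, mul_zero, ofReal_im, I_im, mul_one, sub_self,
          add_zero, add_im, mul_im, zero_add]
        positivity
  rw [tendsto_nhds_unique hlim1 hlim2, show (1 : ℝ) + y ^ 2 = 1 ^ 2 + y ^ 2 by ring, ← he1, ← he2]
  simp only [ofReal_cpow_neg_half]
  rw [intervalIntegral.integral_sub, intervalIntegral.integral_const_mul,
    intervalIntegral.integral_ofReal, intervalIntegral.integral_ofReal]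
  · exact ⟨MeasureTheory.Integrable.ofReal hi1.1, MeasureTheory.Integrable.ofReal hi1.2⟩
  · exact IntervalIntegrable.const_mul
      ⟨MeasureTheory.Integrable.ofReal hi2.1, MeasureTheory.Integrable.ofReal hi2.2⟩ I

/-! ### The complex arithmetic-geometric mean -/

/-- One step of the arithmetic-geometric mean with the near root, written as `a √(g / a)` with the
principal square root; this is the near root whenever `g / a` lies in the slit plane. -/
noncomputable def agmStep (p : ℂ × ℂ) : ℂ × ℂ := ((p.1 + p.2) / 2, p.1 * (p.2 / p.1) ^ (1 / 2 : ℂ))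

lemma agmStep_snd_sq {p : ℂ × ℂ} (hp : p.1 ≠ 0) : (agmStep p).2 ^ 2 = p.1 * p.2 := by
  rw [agmStep, mul_pow, cpow_half_sq]
  field_simp

lemma agmStep_fst_eq {p : ℂ × ℂ} (hp : p.1 ≠ 0) :
    (agmStep p).1 = p.1 * (1 + p.2 / p.1) / 2 := by
  rw [agmStep]
  field_simp

lemma agmStep_ratio {p : ℂ × ℂ} (hp : p.1 ≠ 0) (hz : p.2 / p.1 ∈ slitPlane) :
    (agmStep p).2 / (agmStep p).1 = agmRatio (p.2 / p.1) := by
  have h := one_add_ne_zero_of_mem_slitPlane hz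
  rw [agmStep_fst_eq hp, agmRatio, agmStep]
  field_simp

lemma agmStep_fst_ne_zero {p : ℂ × ℂ} (hp : p.1 ≠ 0) (hz : p.2 / p.1 ∈ slitPlane) :
    (agmStep p).1 ≠ 0 := by
  rw [agmStep_fst_eq hp]
  exact div_ne_zero (mul_ne_zero hp (one_add_ne_zero_of_mem_slitPlane hz)) two_ne_zero

/-- `√(g / a) / (1 + g / a)` has positive real part, so the near root is `a √(g / a)`, whatever the
rule for ties. -/
lemma nearRoot_eq (ε : ℤˣ) {a g : ℂ} (ha : a ≠ 0) (hz : g / a ∈ slitPlane) :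
    nearRoot ε a g = a * (g / a) ^ (1 / 2 : ℂ) := by
  set s := a * (g / a) ^ (1 / 2 : ℂ) with hs
  have h1 : s ^ 2 = a * g := agmStep_snd_sq (p := (a, g)) ha
  have h2 : 0 < (s / (a + g)).re := by
    have h3 : s / (a + g) = agmRatio (g / a) / (2 : ℝ) := by
      have h4 := one_add_ne_zero_of_mem_slitPlane hz
      have h5 : a + g ≠ 0 := by
        intro h0
        apply h4
        field_simp
        rw [h0, mul_zero]
      rw [agmRatio, hs]
      push_cast
      field_simp
    rw [h3, div_ofReal_re]
    exact half_pos (agmRatio_re_pos hz)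
  have h3 : ((a * g) ^ (1 / 2 : ℂ)) ^ 2 = s ^ 2 := by rw [cpow_half_sq, h1]
  unfold nearRoot
  rcases sq_eq_sq_iff_eq_or_eq_neg.mp h3 with h | h
  · simp only [h]
    rw [if_pos (Or.inl h2)]
  · simp only [h]
    rw [if_neg, neg_neg]
    rw [neg_div, neg_re]
    rintro (h4 | ⟨h4, -⟩) <;> linarith

/-- The tie: for reals `0 < g < a` the two roots of `-a g` are equally near to the mean of `a` and
`-g`, and `ε` decides between them. -/
lemma nearRoot_neg (ε : ℤˣ) {a g : ℝ} (hg : 0 < g) (hag : g < a) :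
    nearRoot ε a (-g : ℝ) = ((ε : ℤ) : ℂ) * (Real.sqrt (a * g) * I) := by
  have hpos : 0 < a * g := mul_pos (hg.trans hag) hg
  have h1 : ((a : ℂ) * (-g : ℝ)) ^ (1 / 2 : ℂ) = Real.sqrt (a * g) * I := by
    have h2 : ((a * g : ℝ) : ℂ) ^ (1 / 2 : ℂ) = Real.sqrt (a * g) := by
      rw [Real.sqrt_eq_rpow, ofReal_cpow hpos.le]
      norm_num
    rw [show (a : ℂ) * (-g : ℝ) = ((-(a * g) : ℝ) : ℂ) by push_cast; ring,
      ofReal_cpow_of_nonpos (by linarith), ← ofReal_neg, neg_neg, h2,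
      show (Real.pi : ℂ) * I * (1 / 2) = Real.pi / 2 * I by ring, exp_pi_div_two_mul_I]
  have h3 : (Real.sqrt (a * g) * I / ((a : ℂ) + (-g : ℝ))).re = 0 := by
    rw [← ofReal_add, div_ofReal_re]
    simp
  unfold nearRoot
  simp only [h1, h3, lt_irrefl, false_or, true_and]
  have h4 := Real.sqrt_pos.mpr hpos
  rcases Int.units_eq_one_or ε with rfl | rfl
  · rw [if_pos (by simp)]
    simp
  · rw [if_neg (by simpa using hpos)]
    simp

/-- The geometric mean step does not leave the half-plane `Re ≥ δ`. The modulus follows from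
`Re (√(a g))² ≥ Re a · Re g`, and the sign from the root being within a right angle of both `a` and
`g`. -/
lemma le_re_agmStep_snd {δ : ℝ} (hδ : 0 < δ) {p : ℂ × ℂ} (h1 : δ ≤ p.1.re) (h2 : δ ≤ p.2.re) :
    p.2 / p.1 ∈ slitPlane ∧ δ ≤ (agmStep p).2.re := by
  obtain ⟨a, g⟩ := p
  simp only at h1 h2 ⊢
  have ha : a ≠ 0 := by rintro rfl; simp at h1; linarith
  have hg : g ≠ 0 := by rintro rfl; simp at h2; linarith
  have ha0 : 0 < a.re := hδ.trans_le h1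
  have hg0 : 0 < g.re := hδ.trans_le h2
  have hz : g / a ∈ slitPlane := by
    rw [mem_slitPlane_iff_not_le_zero]
    intro h
    obtain ⟨t, ht⟩ : ∃ t : ℝ, g / a = t := ⟨(g / a).re, by
      apply Complex.ext
      · simp
      · simpa using (Complex.le_def.mp h).2⟩
    have ht0 : t ≤ 0 := by rw [ht] at h; exact_mod_cast h
    have hga : g = t * a := by rw [← ht]; field_simp
    rw [hga] at hg0
    simp at hg0
    nlinarith
  refine ⟨hz, ?_⟩
  have hsq := agmStep_snd_sq (p := (a, g)) ha
  set h := (agmStep (a, g)).2 with hh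
  have hs := cpow_half_re_pos hz
  have hha : 0 < (h / a).re := by
    have : h / a = (g / a) ^ (1 / 2 : ℂ) := by
      simp only [hh, agmStep]
      field_simp
    rwa [this]
  have hh0 : h ≠ 0 := by rintro h0; rw [h0] at hha; simp at hha
  have hhg : 0 < (h / g).re := by
    have h3 : h / g = (h / a)⁻¹ := by
      rw [inv_div, div_eq_div_iff hg hh0, ← pow_two, hsq]
    rw [h3, inv_re]
    exact div_pos hha (normSq_pos.mpr (div_ne_zero hh0 ha))
  rw [div_re_pos_iff ha] at hha
  rw [div_re_pos_iff hg] at hhg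
  have hre : h.re ^ 2 - h.im ^ 2 = a.re * g.re - a.im * g.im := by
    have := congrArg Complex.re hsq
    simpa [pow_two] using this
  have him : 2 * (h.re * h.im) = a.re * g.im + a.im * g.re := by
    have := congrArg Complex.im hsq
    simp [pow_two] at this
    linarith
  have hpos : 0 < h.re := by
    by_contra hneg
    push Not at hneg
    have e1 : 0 < h.im * a.im := by nlinarith
    have e2 : 0 < h.im * g.im := by nlinarith
    have e3 : 2 * (h.re * h.im ^ 2) = a.re * (h.im * g.im) + g.re * (h.im * a.im) := by
      linear_combination h.im * him
    linarith [mul_pos ha0 e2, mul_pos hg0 e1,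
      mul_nonneg (neg_nonneg.mpr hneg) (sq_nonneg h.im)]
  have hnorm : (h.re ^ 2 + h.im ^ 2) ^ 2 =
      (a.re ^ 2 + a.im ^ 2) * (g.re ^ 2 + g.im ^ 2) := by
    calc (h.re ^ 2 + h.im ^ 2) ^ 2
        = (h.re ^ 2 - h.im ^ 2) ^ 2 + (2 * (h.re * h.im)) ^ 2 := by ring
      _ = _ := by rw [hre, him]; ring
  have hge : a.re * g.re + a.im * g.im ≤ h.re ^ 2 + h.im ^ 2 := by
    refine le_of_sq_le_sq ?_ (by positivity)
    rw [hnorm]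
    nlinarith [sq_nonneg (a.re * g.im - a.im * g.re)]
  have hfin : δ ^ 2 ≤ h.re ^ 2 := by nlinarith [mul_le_mul h1 h2 hδ.le ha0.le]
  exact le_of_sq_le_sq hfin hpos.le

/-- The identity `(a' - g') (a' + g') = (a - g)² / 4` and `|a' - g'| ≤ |a' + g'|` give geometric
convergence. -/
lemma norm_agmStep_sub_le {p : ℂ × ℂ} (hp : p.1 ≠ 0) (hz : p.2 / p.1 ∈ slitPlane) :
    ‖(agmStep p).1 - (agmStep p).2‖ ≤ ‖p.1 - p.2‖ / 2 := by
  have h0 := agmStep_fst_ne_zero hp hz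
  have hsq := agmStep_snd_sq hp
  have hre : 0 < ((agmStep p).2 / (agmStep p).1).re := by
    rw [agmStep_ratio hp hz]; exact agmRatio_re_pos hz
  have hfst : (agmStep p).1 = (p.1 + p.2) / 2 := rfl
  set a := (agmStep p).1
  set g := (agmStep p).2
  rw [div_re_pos_iff h0] at hre
  have h1 : ‖a - g‖ ^ 2 ≤ ‖a + g‖ ^ 2 := by
    rw [← normSq_eq_norm_sq, ← normSq_eq_norm_sq, normSq_apply, normSq_apply]
    simp only [sub_re, sub_im, add_re, add_im]
    nlinarith
  have h2 : ‖a - g‖ ≤ ‖a + g‖ := le_of_sq_le_sq h1 (norm_nonneg _)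
  have h3 : ‖a - g‖ * ‖a + g‖ = (‖p.1 - p.2‖ / 2) ^ 2 := by
    rw [← norm_mul, show (a - g) * (a + g) = ((p.1 - p.2) / 2) ^ 2 by
      rw [hfst]
      have : (p.1 + p.2) ^ 2 / 4 - g ^ 2 = ((p.1 - p.2) / 2) ^ 2 := by rw [hsq]; ring
      linear_combination this, norm_pow, norm_div]
    norm_num
  exact le_of_sq_le_sq (by nlinarith [norm_nonneg (a - g)]) (by positivity)

/-- The complex form of Gauss's theorem. The ratio `g / a` may lie on the imaginary axis, so the
value is expressed by Gauss's integral after one step. -/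
theorem exists_tendsto_agmStep_iterate {a : ℝ} {g : ℂ} (ha : 0 < a) (hz : g / a ∈ slitPlane)
    (hre : 0 ≤ (g / a).re) :
    (∀ n, (agmStep^[n] (a, g)).1 ≠ 0 ∧
        (agmStep^[n] (a, g)).2 / (agmStep^[n] (a, g)).1 ∈ slitPlane) ∧
      ∃ M : ℂ, M ≠ 0 ∧ Tendsto (fun n => (agmStep^[n] (a, g)).1) atTop (𝓝 M) ∧
        Tendsto (fun n => (agmStep^[n] (a, g)).2) atTop (𝓝 M) ∧
        (Real.pi : ℂ) / (2 * M) = complexGaussStep (g / a) / a := by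
  have ha' : (a : ℂ) ≠ 0 := by exact_mod_cast ha.ne'
  set s : ℕ → ℂ × ℂ := fun n => agmStep^[n] (a, g) with hs
  have hstep : ∀ n, s (n + 1) = agmStep (s n) := fun n => Function.iterate_succ_apply' _ _ _
  have hs0 : s 0 = (↑a, g) := rfl
  -- After one step both terms lie in the right half-plane, at a positive distance from its edge.
  obtain ⟨δ, hδ, h1⟩ : ∃ δ : ℝ, 0 < δ ∧ δ ≤ (s 1).1.re ∧ δ ≤ (s 1).2.re := by
    have e1 : 0 < (s 1).1.re := by
      rw [hstep, hs0, agmStep_fst_eq ha',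
        show (a : ℂ) * (1 + g / a) / 2 = ((a / 2 : ℝ) : ℂ) * (1 + g / a) by push_cast; ring,
        re_ofReal_mul, add_re, one_re]
      positivity
    have e2 : 0 < (s 1).2.re := by
      rw [hstep, hs0, agmStep, re_ofReal_mul]
      exact mul_pos ha (cpow_half_re_pos hz)
    exact ⟨min (s 1).1.re (s 1).2.re, lt_min e1 e2, min_le_left _ _, min_le_right _ _⟩
  have hδn : ∀ n, δ ≤ (s (n + 1)).1.re ∧ δ ≤ (s (n + 1)).2.re := by
    intro n
    induction n with
    | zero => exact h1
    | succ n ih =>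
      refine ⟨?_, ?_⟩
      · rw [hstep, agmStep, show ((s (n + 1)).1 + (s (n + 1)).2) / 2 =
          ((s (n + 1)).1 + (s (n + 1)).2) / (2 : ℝ) by norm_num, div_ofReal_re, add_re]
        linarith [ih.1, ih.2]
      · rw [hstep]
        exact (le_re_agmStep_snd hδ ih.1 ih.2).2
  have hprop : ∀ n, (s n).1 ≠ 0 ∧ (s n).2 / (s n).1 ∈ slitPlane := by
    intro n
    cases n with
    | zero => exact ⟨ha', hz⟩
    | succ n =>
      refine ⟨?_, (le_re_agmStep_snd hδ (hδn n).1 (hδn n).2).1⟩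
      intro h0
      have := (hδn n).1
      rw [h0, zero_re] at this
      linarith
  refine ⟨hprop, ?_⟩
  have hdiff : ∀ n, ‖(s n).1 - (s n).2‖ ≤ ‖(a : ℂ) - g‖ * (1 / 2) ^ n := by
    intro n
    induction n with
    | zero => simp [hs0]
    | succ n ih =>
      rw [hstep]
      refine (norm_agmStep_sub_le (hprop n).1 (hprop n).2).trans ?_
      rw [pow_succ]
      linarith
  have hcauchy : CauchySeq fun n => (s n).1 := by
    refine cauchySeq_of_le_geometric (1 / 2) ‖(a : ℂ) - g‖ (by norm_num) fun n => ?_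
    rw [dist_eq_norm, hstep, agmStep,
      show (s n).1 - ((s n).1 + (s n).2) / 2 = ((s n).1 - (s n).2) / 2 by ring, norm_div]
    have := hdiff n
    have h2 : ‖(2 : ℂ)‖ = 2 := by simp
    rw [h2]
    linarith [norm_nonneg ((s n).1 - (s n).2)]
  obtain ⟨M, hM⟩ := cauchySeq_tendsto_of_complete hcauchy
  have hd0 : Tendsto (fun n => (s n).1 - (s n).2) atTop (𝓝 0) := by
    refine squeeze_zero_norm hdiff ?_
    simpa using (tendsto_pow_atTop_nhds_zero_of_lt_one (r := (1 / 2 : ℝ)) (by norm_num)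
      (by norm_num)).const_mul ‖(a : ℂ) - g‖
  have hM2 : Tendsto (fun n => (s n).2) atTop (𝓝 M) := by
    simpa using hM.sub hd0
  have hMre : δ ≤ M.re :=
    ge_of_tendsto' ((continuous_re.tendsto M).comp ((tendsto_add_atTop_iff_nat 1).mpr hM))
      fun n => (hδn n).1
  have hM0 : M ≠ 0 := by
    rintro rfl
    rw [zero_re] at hMre
    linarith
  refine ⟨M, hM0, hM, hM2, ?_⟩
  have hinv : ∀ n, complexGauss ((s (n + 1)).2 / (s (n + 1)).1) / (s (n + 1)).1 =
      complexGaussStep (g / a) / a := by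
    have hconv : ∀ n, complexGauss ((s (n + 1)).2 / (s (n + 1)).1) / (s (n + 1)).1 =
        complexGaussStep ((s n).2 / (s n).1) / (s n).1 := by
      intro n
      have hn := hprop n
      have hne := one_add_ne_zero_of_mem_slitPlane hn.2
      rw [hstep, agmStep_ratio hn.1 hn.2, agmStep_fst_eq hn.1, complexGaussStep]
      generalize (s n).2 / (s n).1 = z at *
      have := hn.1
      field_simp
    intro n
    induction n with
    | zero => exact hconv 0
    | succ n ih =>
      rw [hconv, ← ih, complexGauss_eq_step]
      rw [hstep, agmStep_ratio (hprop n).1 (hprop n).2]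
      exact agmRatio_re_pos (hprop n).2
  have hlim : Tendsto (fun n => complexGauss ((s (n + 1)).2 / (s (n + 1)).1) / (s (n + 1)).1) atTop
      (𝓝 (complexGauss 1 / M)) := by
    refine (tendsto_add_atTop_iff_nat
      (f := fun n => complexGauss ((s n).2 / (s n).1) / (s n).1) 1).mpr (Tendsto.div ?_ hM hM0)
    have h3 := hM2.div hM hM0
    rw [div_self hM0] at h3
    exact (differentiableAt_complexGauss (by simp)).continuousAt.tendsto.comp h3
  simp only [hinv] at hlim
  rw [← tendsto_nhds_unique hlim tendsto_const_nhds, complexGauss_one, div_div]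

lemma signedAGMSeq_add_eq_iterate {ε : ℤˣ} {σ : ℕ → ℤˣ} {a g a' g' : ℂ} {N : ℕ}
    (hσ : ∀ n, N ≤ n → σ n = 1) (hN : signedAGMSeq ε σ a g N = (a', g'))
    (hprop : ∀ n, (agmStep^[n] (a', g')).1 ≠ 0 ∧
      (agmStep^[n] (a', g')).2 / (agmStep^[n] (a', g')).1 ∈ slitPlane) (n : ℕ) :
    signedAGMSeq ε σ a g (n + N) = agmStep^[n] (a', g') := by
  induction n with
  | zero => rw [zero_add, hN]; rfl
  | succ n ih =>
    rw [Function.iterate_succ_apply', add_right_comm, signedAGMSeq]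
    rw [ih, hσ _ (by lia), nearRoot_eq ε (hprop n).1 (hprop n).2, agmStep]
    simp

/-- If from some index on all signs are `+`, the signed mean is an ordinary complex
arithmetic-geometric mean. -/
lemma exists_hasSignedAGM {ε : ℤˣ} {σ : ℕ → ℤˣ} {a g g' : ℂ} {a' : ℝ} {N : ℕ}
    (hσ : ∀ n, N ≤ n → σ n = 1) (hN : signedAGMSeq ε σ a g N = (↑a', g')) (ha' : 0 < a')
    (hz : g' / a' ∈ slitPlane) (hre : 0 ≤ (g' / a').re) :
    ∃ M : ℂ, M ≠ 0 ∧ HasSignedAGM ε σ a g M ∧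
      (Real.pi : ℂ) / (2 * M) = complexGaussStep (g' / a') / a' := by
  obtain ⟨hprop, M, hM0, hM1, hM2, hval⟩ := exists_tendsto_agmStep_iterate ha' hz hre
  have hseq := signedAGMSeq_add_eq_iterate hσ hN hprop
  refine ⟨M, hM0, ⟨?_, ?_⟩, hval⟩
  · rw [← tendsto_add_atTop_iff_nat N]
    simpa only [hseq] using hM1
  · rw [← tendsto_add_atTop_iff_nat N]
    simpa only [hseq] using hM2

/-! ### The two signed means -/

lemma gaussIntegral_half_mul (a b : ℝ) :
    gaussIntegral (a / 2) (b / 2) = 2 * gaussIntegral a b := by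
  have h := gaussIntegral_mul (c := 1 / 2) (by norm_num) a b
  rw [show a / 2 = 1 / 2 * a by ring, show b / 2 = 1 / 2 * b by ring, h]
  ring

lemma gaussIntegral_add_sub {a b : ℝ} (hba : |b| < a) :
    gaussIntegral (a + b) (a - b) = gaussIntegral a (Real.sqrt (a ^ 2 - b ^ 2)) := by
  obtain ⟨h1, h2⟩ := abs_lt.mp hba
  rw [gaussIntegral_agm_step (by linarith) (by linarith)]
  congr 2 <;> ring

section SignedMeans

variable {b : ℝ}

/-- Two arithmetic-geometric mean steps lead from `(2 (1 + b), 2 (1 - b))` to the pair whose Gauss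
integral is the imaginary part of the second mean. -/
lemma gaussIntegral_eq_four_mul_ellipticK (hb0 : 0 < b) (hb1 : b < 1) :
    gaussIntegral (((1 + b) / 2 + Real.sqrt b) / 2) (((1 + b) / 2 - Real.sqrt b) / 2) =
      4 * ellipticK b := by
  have hs : Real.sqrt b ^ 2 = b := Real.sq_sqrt hb0.le
  have hs1 : Real.sqrt b < 1 := by rw [Real.sqrt_lt' one_pos]; linarith
  have hab : |Real.sqrt b| < (1 + b) / 2 := by
    rw [abs_of_nonneg (Real.sqrt_nonneg b)]
    nlinarith
  have h1 : Real.sqrt (((1 + b) / 2) ^ 2 - Real.sqrt b ^ 2) = (1 - b) / 2 := by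
    rw [hs, show ((1 + b) / 2) ^ 2 - b = ((1 - b) / 2) ^ 2 by ring, Real.sqrt_sq (by linarith)]
  have h2 : |b| < 1 := by rw [abs_of_pos hb0]; exact hb1
  rw [gaussIntegral_half_mul, gaussIntegral_add_sub hab, h1, gaussIntegral_half_mul,
    gaussIntegral_add_sub h2, one_pow, ← ellipticK_eq_gaussIntegral (by nlinarith)]
  ring

lemma gaussIntegral_eq_gaussIntegral_one (hb0 : 0 < b) :
    gaussIntegral (((1 + b) / 2 + Real.sqrt b) / 2) (Real.sqrt ((1 + b) / 2 * Real.sqrt b)) =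
      gaussIntegral 1 b := by
  rw [← gaussIntegral_agm_step (by positivity) (Real.sqrt_pos.mpr hb0),
    gaussIntegral_agm_step one_pos hb0, one_mul]

lemma complexGaussStep_sign_mul_I (ε : ℤˣ) {y : ℝ} (hy : 0 < y) :
    complexGaussStep (((ε : ℤ) : ℂ) * (y * I)) = gaussIntegral (Real.sqrt (1 + y ^ 2)) y -
      ((ε : ℤ) : ℂ) * (I * gaussIntegral (Real.sqrt (1 + y ^ 2)) 1) := by
  rcases Int.units_eq_one_or ε with rfl | rfl
  · simpa using complexGaussStep_mul_I hy
  · have hmem : (y * I : ℂ) ∈ slitPlane := mem_slitPlane_iff.mpr (Or.inr (by simpa using hy.ne'))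
    have h := complexGaussStep_conj hmem
    rw [complexGaussStep_mul_I hy] at h
    simpa using h

/-- For a positive real `a` and a purely imaginary `± i m`, the value of the complex mean splits
into two real Gauss integrals. -/
lemma complexGaussStep_imag_div (ε : ℤˣ) {a m : ℝ} (ha : 0 < a) (hm : 0 < m) :
    complexGaussStep (((ε : ℤ) : ℂ) * (m * I) / a) / a =
      gaussIntegral (Real.sqrt (a ^ 2 + m ^ 2)) m -
        ((ε : ℤ) : ℂ) * (I * gaussIntegral (Real.sqrt (a ^ 2 + m ^ 2)) a) := by
  have hR : a * Real.sqrt (1 + (m / a) ^ 2) = Real.sqrt (a ^ 2 + m ^ 2) := by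
    rw [← Real.sqrt_sq ha.le, ← Real.sqrt_mul (sq_nonneg _), Real.sqrt_sq ha.le]
    congr 1
    field_simp
  have h1 := gaussIntegral_mul ha (Real.sqrt (1 + (m / a) ^ 2)) (m / a)
  have h2 := gaussIntegral_mul ha (Real.sqrt (1 + (m / a) ^ 2)) 1
  rw [hR, mul_div_cancel₀ _ ha.ne'] at h1
  rw [hR, mul_one] at h2
  rw [show ((ε : ℤ) : ℂ) * (m * I) / a = ((ε : ℤ) : ℂ) * ((m / a : ℝ) * I) by push_cast; ring,
    complexGaussStep_sign_mul_I ε (div_pos hm ha), h1, h2]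
  push_cast
  ring

theorem exists_hasSignedAGM_allPlus (ε : ℤˣ) (hb0 : 0 < b) :
    ∃ M : ℂ, M ≠ 0 ∧ HasSignedAGM ε allPlus 1 (b : ℂ) M ∧
      (Real.pi : ℂ) / (2 * M) = gaussIntegral 1 b := by
  obtain ⟨M, hM0, hM, hval⟩ := exists_hasSignedAGM (ε := ε) (σ := allPlus) (a := 1) (g := b)
    (a' := 1) (g' := b) (N := 0) (fun _ _ => rfl) (by rw [signedAGMSeq, ofReal_one]) one_pos
    (by simpa using hb0) (by simpa using hb0.le)
  refine ⟨M, hM0, hM, ?_⟩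
  rw [hval, ofReal_one, div_one, div_one, ← complexGauss_eq_step_ofReal hb0, complexGauss_ofReal]

theorem exists_hasSignedAGM_firstMinus (ε : ℤˣ) (hb0 : 0 < b) (hb1 : b < 1) :
    ∃ M : ℂ, M ≠ 0 ∧ HasSignedAGM ε firstMinus 1 (b : ℂ) M ∧
      (Real.pi : ℂ) / (2 * M) =
        gaussIntegral 1 b - ((ε : ℤ) : ℂ) * (4 * I * ellipticK b) := by
  have hsb : 0 < Real.sqrt b := Real.sqrt_pos.mpr hb0
  have hs : Real.sqrt b ^ 2 = b := Real.sq_sqrt hb0.le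
  have hs1 : Real.sqrt b < 1 := by rw [Real.sqrt_lt' one_pos]; linarith
  have hab : Real.sqrt b < (1 + b) / 2 := by nlinarith
  set m := Real.sqrt ((1 + b) / 2 * Real.sqrt b) with hm
  set a₂ := ((1 + b) / 2 - Real.sqrt b) / 2 with ha₂
  have ha₂0 : 0 < a₂ := by rw [ha₂]; linarith
  have hm0 : 0 < m := Real.sqrt_pos.mpr (by positivity)
  have hseq1 : signedAGMSeq ε firstMinus 1 (b : ℂ) 1 =
      ((((1 + b) / 2 : ℝ) : ℂ), ((-Real.sqrt b : ℝ) : ℂ)) := by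
    have hmem : (b : ℂ) / 1 ∈ slitPlane := by simpa using hb0
    simp only [signedAGMSeq, firstMinus]
    rw [nearRoot_eq ε one_ne_zero hmem, div_one, one_mul, Real.sqrt_eq_rpow, ofReal_neg,
      ofReal_cpow hb0.le]
    simp
  have hseq2 : signedAGMSeq ε firstMinus 1 (b : ℂ) 2 = (↑a₂, ((ε : ℤ) : ℂ) * (m * I)) := by
    rw [signedAGMSeq, hseq1]
    simp only
    rw [nearRoot_neg ε hsb hab, ha₂, hm]
    simp [firstMinus]
    ring
  have hratio : ((ε : ℤ) : ℂ) * (m * I) / a₂ = ((((ε : ℤ) : ℝ) * (m / a₂) : ℝ) : ℂ) * I := by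
    push_cast; ring
  have hε : (((ε : ℤ) : ℝ)) ≠ 0 := by
    rcases Int.units_eq_one_or ε with rfl | rfl <;> simp
  obtain ⟨M, hM0, hM, hval⟩ := exists_hasSignedAGM (ε := ε) (σ := firstMinus) (a := 1) (g := b)
    (N := 2) (fun n hn => by simp [firstMinus, show n ≠ 0 by lia]) hseq2 ha₂0
    (by
      rw [hratio, mem_slitPlane_iff]
      right
      rw [im_ofReal_mul, I_im, mul_one]
      exact mul_ne_zero hε (div_pos hm0 ha₂0).ne')
    (by rw [hratio]; simp)
  refine ⟨M, hM0, hM, ?_⟩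
  have hc : Real.sqrt (a₂ ^ 2 + m ^ 2) = ((1 + b) / 2 + Real.sqrt b) / 2 := by
    rw [hm, Real.sq_sqrt (by positivity), ha₂,
      show (((1 + b) / 2 - Real.sqrt b) / 2) ^ 2 + (1 + b) / 2 * Real.sqrt b =
        (((1 + b) / 2 + Real.sqrt b) / 2) ^ 2 by ring, Real.sqrt_sq (by positivity)]
  rw [hval, complexGaussStep_imag_div ε ha₂0 hm0, hc, gaussIntegral_eq_gaussIntegral_one hb0,
    gaussIntegral_eq_four_mul_ellipticK hb0 hb1]
  push_cast
  ring

end SignedMeans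

theorem mainTheorem2 (k b : ℝ) (hk0 : 0 < k) (hk1 : k < 1) (hb : b = Real.sqrt (1 - k ^ 2)) :
    -- the two AGMs and the difference of their scaled inverses, for both resolutions of the tie
    (∀ ε : ℤˣ, ∃ M₀ M : ℂ, M₀ ≠ 0 ∧ M ≠ 0 ∧
      HasSignedAGM ε allPlus 1 (b : ℂ) M₀ ∧
      HasSignedAGM ε firstMinus 1 (b : ℂ) M ∧
      (Real.pi : ℂ) / (2 * M₀) = ellipticK k ∧
      (Real.pi : ℂ) / (2 * M) =
        ellipticK k - ((ε : ℤ) : ℂ) * (4 * Complex.I * ellipticK b) ∧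
      (Real.pi : ℂ) / (2 * M₀) - (Real.pi : ℂ) / (2 * M) =
        ((ε : ℤ) : ℂ) * (4 * Complex.I * ellipticK b)) ∧
    -- `4 i K(b)` generates, with `4 K(k)`, the lattice of common periods of `sn`, `cn`, `dn`
    {ω : ℂ | Function.Periodic (jacobiSN k) ω ∧ Function.Periodic (jacobiCN k) ω ∧
        Function.Periodic (jacobiDN k) ω} =
      (AddSubgroup.closure
        {4 * (ellipticK k : ℂ), 4 * Complex.I * (ellipticK b : ℂ)} : Set ℂ) ∧
    -- the double Landen transformation
    (∀ q v c w : ℝ, 0 < q → q < 1 → 0 < c → c < 1 →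
      k = 2 * Real.sqrt q / (1 + q) → v = Real.sqrt (1 - q ^ 2) →
      q = 2 * Real.sqrt c / (1 + c) → w = 2 * Real.sqrt v / (1 + v) →
      ellipticK k = 2 / (1 + b) * (2 / (1 + v)) * ellipticK c ∧
      ellipticK w = 2 / (1 + c) * (2 / (1 + q)) * ellipticK b ∧
      ellipticK k * ellipticK w = 4 * ellipticK b * ellipticK c) := by
  have hk2 : k ^ 2 < 1 := by nlinarith
  have hb0 : 0 < b := hb ▸ Real.sqrt_pos.mpr (by linarith)
  have hb1 : b < 1 := by
    rw [hb, Real.sqrt_lt' one_pos]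
    nlinarith
  have hK : ellipticK k = gaussIntegral 1 b := by rw [ellipticK_eq_gaussIntegral hk2.le, hb]
  refine ⟨fun ε => ?_, ?_, fun q v c w hq0 hq1 hc0 hc1 hk hv hq hw =>
    ellipticK_double_landen hb hq0 hq1 hc0 hc1 hk hv hq hw⟩
  · obtain ⟨M₀, hM₀, hlim₀, hval₀⟩ := exists_hasSignedAGM_allPlus ε hb0
    obtain ⟨M, hM, hlim, hval⟩ := exists_hasSignedAGM_firstMinus ε hb0 hb1
    rw [← hK] at hval₀ hval
    exact ⟨M₀, M, hM₀, hM, hlim₀, hlim, hval₀, hval, by rw [hval₀, hval]; ring⟩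
  · rw [hb]
    exact setOf_common_periods_eq hk0 hk1
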